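/- For $0\le q\le p\le 1$ let $\mathcal G(N,q)$ be the Erdős–Rényi graph on $[N]$, and let $\mathcal G(N,K,p,q)$ be the random graph on $[N]$ in which each vertex belongs to a random set $S$ independently with probability $K/N$ and, given $S$, any two vertices are joined independently, with probability $p$ if both lie in $S$ and $q$ otherwise. Let $\mathcal G(n,k,\gamma)$ be obtained from $\mathcal G(n,\gamma)$ by adding all edges among $k$ uniformly chosen vertices. $\mathrm{PDS}(N,K,p,q)$ is the problem of testing $\mathcal G(N,q)$ against $\mathcal G(N,K,p,q)$, and $\mathrm{PC}(n,k,\gamma)$ that of testing $\mathcal G(n,\gamma)$ against $\mathcal G(n,k,\gamma)$. The Type-I+II error probability of a (possibly randomized) test is the probability of output $1$ under the first law plus the probability of output $0$ under the second. Let $\ell,n\ge 1$ be integers, $1\le k\le n$, $0<\gamma\le\frac12$, $q>0$, and put $N=\ell n$, $K=k\ell$, $p=2q$, $m_0=\lfloor\log_2(1/\gamma)\rfloor$. Assume $16q\ell^2\le 1$ and $k\ge 6e\ell$. For a graph $G$ on $[n]$ define a random graph $\widetilde G$ on $[N]$ as follows. Each vertex in $[N]$ independently chooses a uniformly random parent in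 $[n]$; let $V_s$ be the set of vertices with parent $s$ and $\ell_s=|V_s|$. Given the parents, the numbers $E(V_s,V_t)$ ($1\le s\le t\le n$) of edges of $\widetilde G$ between $V_s$ and $V_t$ are independent, with $E(V_s,V_s)\sim\mathrm{Binom}(\binom{\ell_s}{2},q)$ and, for $s<t$ and $L=\ell_s\ell_t$, $$E(V_s,V_t)\sim\begin{cases}P'_L & \text{if } \ell_s,\ell_t\le 2\ell \text{ and } s,t \text{ are adjacent in } G,\\ Q'_L & \text{if } \ell_s,\ell_t\le 2\ell \text{ and } s,t \text{ are not adjacent in } G,\\ Q_L & \text{if }\max\{\ell_s,\ell_t\}>2\ell.\end{cases}$$ Given these numbers, independently for each pair $s\le t$, the set of edges between $V_s$ and $V_t$ is uniformly random among the sets of $E(V_s,V_t)$ admissible pairs. Here $P_L=\mathrm{Binom}(L,p)$, $Q_L=\mathrm{Binom}(L,q)$, $$P'_L(0)=P_L(0)+\sum_{m_0<m\le L}\Big[P_L(m)-\tfrac1\gamma Q_L(m)\Big],\qquad P'_L(m)=P_L(m)\ (1\le m\le m_0),\qquad P'_L(m)=\tfrac1\gamma Q_L(m)\ (m_0<m\le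 L),$$ and $Q'_L=\frac{1}{1-\gamma}(Q_L-\gamma P'_L)$. Then $P'_{ab}$ and $Q'_{ab}$ are probability distributions on $\{0,\dots,ab\}$ for all integers $0\le a,b\le 2\ell$, so that the law of $\widetilde G$ given $G$ is a well-defined probability distribution. Moreover, for every test $\phi$ (a map from the graphs on $[N]$ to $\{0,1\}$) whose Type-I+II error probability for $\mathrm{PDS}(N,K,2q,q)$ is $\eta$, the map $G\mapsto\phi(\widetilde G)$ is a randomized test for $\mathrm{PC}(n,k,\gamma)$ whose Type-I+II error probability is at most $\eta+\xi$, where $$\xi=e^{-\frac{K}{12}}+1.5\,k\,e^{-\frac{\ell}{18}}+2k^2(8q\ell^2)^{m_0+1}+0.5\sqrt{e^{72e^2q\ell^2}-1}+\sqrt{0.5\,k}\;e^{-\frac{\ell}{36}}.$$ -/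

import Mathlib

noncomputable section

/-- `μ` is the mass function of a probability distribution on the finite type `Ω`. -/
def IsProbMass {Ω : Type*} [Fintype Ω] (μ : Ω → ℝ) : Prop :=
  (∀ ω, 0 ≤ μ ω) ∧ ∑ ω, μ ω = 1

/-- `μ` is the mass function of a probability distribution on `{0, …, L}`. -/
def IsProbMassUpTo (L : ℕ) (μ : ℕ → ℝ) : Prop :=
  (∀ m, m ≤ L → 0 ≤ μ m) ∧ (∀ m, L < m → μ m = 0) ∧ ∑ m ∈ Finset.range (L + 1), μ m = 1

/-- The mass function of the binomial distribution with `L` trials and success probability `r`. -/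
def binomMass (L : ℕ) (r : ℝ) (m : ℕ) : ℝ :=
  (L.choose m : ℝ) * r ^ m * (1 - r) ^ (L - m)

/-! ### Random graphs -/

open Classical in
/-- The law of the random graph on `Fin N` in which the unordered pairs `e` of distinct vertices
are edges independently, the pair `e` with probability `w e`. -/
def indepEdgeMass (N : ℕ) (w : Sym2 (Fin N) → ℝ) (H : SimpleGraph (Fin N)) : ℝ :=
  ∏ e : Sym2 (Fin N) with ¬ e.IsDiag, if e ∈ H.edgeSet then w e else 1 - w e

/-- The mass function of the Erdős–Rényi random graph `𝒢(N, q)`, for `0 ≤ q ≤ 1` (other values of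
`q` are clamped to `[0, 1]`). -/
def erdosRenyiMass (N : ℕ) (q : ℝ) (H : SimpleGraph (Fin N)) : ℝ :=
  (SimpleGraph.binomialRandom (Fin N) (Set.projIcc 0 1 zero_le_one q)).real {H}

/-- The explicit form of `erdosRenyiMass`. -/
theorem erdosRenyiMass_eq (N : ℕ) (q : ℝ) (hq0 : 0 ≤ q) (hq1 : q ≤ 1) (H : SimpleGraph (Fin N)) :
    erdosRenyiMass N q H = indepEdgeMass N (fun _ => q) H := by
  classical
  have hproj : (Set.projIcc (0 : ℝ) 1 zero_le_one q) = ⟨q, hq0, hq1⟩ :=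
    Set.projIcc_of_mem zero_le_one ⟨hq0, hq1⟩
  have hset : (Finset.univ.filter fun e : Sym2 (Fin N) => ¬ e.IsDiag ∧ e ∈ H.edgeSet)
      = H.edgeFinset := by
    ext e
    simp only [Finset.mem_filter, Finset.mem_univ, true_and, SimpleGraph.mem_edgeFinset]
    exact ⟨fun h => h.2, fun h => ⟨H.not_isDiag_of_mem_edgeSet h, h⟩⟩
  have hall : (Finset.univ.filter fun e : Sym2 (Fin N) => ¬ e.IsDiag).card = N.choose 2 := by
    have := Sym2.card_subtype_not_diag (α := Fin N)
    rw [Fintype.card_subtype] at this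
    simpa using this
  have hsplit := Finset.card_filter_add_card_filter_not
    (s := Finset.univ.filter fun e : Sym2 (Fin N) => ¬ e.IsDiag) (fun e => e ∈ H.edgeSet)
  rw [hall, Finset.filter_filter, hset] at hsplit
  have hcard : H.edgeSet.ncard = H.edgeFinset.card := by
    rw [← SimpleGraph.coe_edgeFinset, Set.ncard_coe_finset]
  rw [erdosRenyiMass, hproj, MeasureTheory.measureReal_def, SimpleGraph.binomialRandom_singleton,
    indepEdgeMass, Finset.prod_ite, Finset.prod_const, Finset.prod_const, Finset.filter_filter,
    hset, hcard, Nat.card_fin, ← hsplit, Nat.add_sub_cancel_left]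
  simp [unitInterval.toNNReal, unitInterval.symm]
  rfl

open Classical in
/-- The planted dense subgraph model `𝒢(N, K, p, q)`: every vertex belongs to the random set `S`
independently with probability `K / N`; given `S`, two vertices are joined independently with
probability `p` if both are in `S`, and with probability `q` otherwise. -/
def plantedDenseMass (N K : ℕ) (p q : ℝ) (H : SimpleGraph (Fin N)) : ℝ :=
  ∑ S : Finset (Fin N),
    ((K : ℝ) / N) ^ S.card * (1 - (K : ℝ) / N) ^ (N - S.card) *
      indepEdgeMass N (fun e => if ∀ v ∈ e, v ∈ S then p else q) H

/-- The graph whose edges are all the pairs of distinct vertices of `C`. -/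
def cliqueOn {n : ℕ} (C : Finset (Fin n)) : SimpleGraph (Fin n) :=
  SimpleGraph.fromRel (fun u v => u ∈ C ∧ v ∈ C)

open Classical in
/-- The planted clique model `𝒢(n, k, γ)`: a sample of `𝒢(n, γ)`, to which all edges inside an
independent, uniformly random set `C` of `k` vertices are added. -/
def plantedCliqueMass (n k : ℕ) (γ : ℝ) (G : SimpleGraph (Fin n)) : ℝ :=
  ∑ C ∈ Finset.powersetCard k (Finset.univ : Finset (Fin n)),
    ((n.choose k : ℝ))⁻¹ *
      ∑ G₀ : SimpleGraph (Fin n), erdosRenyiMass n γ G₀ * (if G₀ ⊔ cliqueOn C = G then 1 else 0)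

/-! ### Tests -/

/-- The Type-I+II error probability `P₀{ψ = 1} + P₁{ψ = 0}` of a (possibly randomized) test `ψ` of
`P₀` against `P₁`, where `ψ ω b` is the probability that the test outputs `b` on input `ω`. -/
def errorSum {Ω : Type*} [Fintype Ω] (P₀ P₁ : Ω → ℝ) (ψ : Ω → Bool → ℝ) : ℝ :=
  ∑ ω, P₀ ω * ψ ω true + ∑ ω, P₁ ω * ψ ω false

/-- A deterministic test, seen as a randomized one. -/
def detTest {Ω : Type*} (φ : Ω → Bool) (ω : Ω) (b : Bool) : ℝ :=
  if φ ω = b then 1 else 0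

/-- The randomized test `ω ↦ φ(ω')` where, given `ω`, the point `ω'` is drawn from `R ω`. -/
def compTest {Ω Ω' : Type*} [Fintype Ω'] (R : Ω → Ω' → ℝ) (φ : Ω' → Bool) (ω : Ω) (b : Bool) : ℝ :=
  ∑ ω', R ω ω' * detTest φ ω' b

/-- The Type-I+II error probability of a deterministic test for `PDS(N, K, p, q)`. -/
def pdsError (N K : ℕ) (p q : ℝ) (φ : SimpleGraph (Fin N) → Bool) : ℝ :=
  errorSum (erdosRenyiMass N q) (plantedDenseMass N K p q) (detTest φ)

/-- The Type-I+II error probability of a randomized test for `PC(n, k, γ)`. -/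
def pcError (n k : ℕ) (γ : ℝ) (ψ : SimpleGraph (Fin n) → Bool → ℝ) : ℝ :=
  errorSum (erdosRenyiMass n γ) (plantedCliqueMass n k γ) ψ

/-! ### The randomized reduction -/

/-- `m₀ = ⌊log₂ (1 / γ)⌋`. -/
def mZero (γ : ℝ) : ℕ := ⌊Real.logb 2 (1 / γ)⌋₊

/-- The mass function `P'_L`, for `P_L = Binom(L, p)` and `Q_L = Binom(L, q)`. -/
def pPrimeMass (p q γ : ℝ) (L m : ℕ) : ℝ :=
  if m = 0 then
    binomMass L p 0 + ∑ j ∈ Finset.Ioc (mZero γ) L, (binomMass L p j - 1 / γ * binomMass L q j)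
  else if m ≤ mZero γ then binomMass L p m
  else 1 / γ * binomMass L q m

/-- The mass function `Q'_L = (Q_L - γ P'_L) / (1 - γ)`. -/
def qPrimeMass (p q γ : ℝ) (L m : ℕ) : ℝ :=
  1 / (1 - γ) * (binomMass L q m - γ * pPrimeMass p q γ L m)

/-- The number `ℓ_s` of children of `s`, where `V i` is the parent of the vertex `i`. -/
def numChildren {n N : ℕ} (V : Fin N → Fin n) (s : Fin n) : ℕ :=
  (Finset.univ.filter fun i => V i = s).card

open Classical in
/-- The unordered pairs of distinct vertices, one with parent `s` and the other with parent `t`. -/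
def blockPairs {n N : ℕ} (V : Fin N → Fin n) (s t : Fin n) : Finset (Sym2 (Fin N)) :=
  Finset.univ.filter fun e => ¬ e.IsDiag ∧ e.map V = s(s, t)

open Classical in
/-- The number `E(V_s, V_t)` of edges of `H` between the children of `s` and those of `t`. -/
def numBlockEdges {n N : ℕ} (V : Fin N → Fin n) (s t : Fin n) (H : SimpleGraph (Fin N)) : ℕ :=
  ((blockPairs V s t).filter fun e => e ∈ H.edgeSet).card

open Classical in
/-- The conditional mass function of `E(V_s, V_t)` given the parents `V` and the input graph `G`. -/
def edgeCountMass {n N : ℕ} (ℓ : ℕ) (p q γ : ℝ) (G : SimpleGraph (Fin n)) (V : Fin N → Fin n)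
    (s t : Fin n) (m : ℕ) : ℝ :=
  if s = t then binomMass ((numChildren V t).choose 2) q m
  else if 2 * ℓ < max (numChildren V s) (numChildren V t) then
    binomMass (numChildren V s * numChildren V t) q m
  else if G.Adj s t then pPrimeMass p q γ (numChildren V s * numChildren V t) m
  else qPrimeMass p q γ (numChildren V s * numChildren V t) m

/-- The randomized reduction, as a kernel: `reductionMass ℓ p q γ G H` is the probability that the
output graph is `H` when the input graph is `G`. The parents `V i` of the vertices are independent
and uniform on `Fin n`; given `V`, the blocks `s ≤ t` are independent, the number of edges of the
block `(s, t)` has law `edgeCountMass`, and given their number `m`, the set of edges in the block is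
uniform among the sets of `m` pairs of that block. -/
def reductionMass {n N : ℕ} (ℓ : ℕ) (p q γ : ℝ) (G : SimpleGraph (Fin n))
    (H : SimpleGraph (Fin N)) : ℝ :=
  ∑ V : Fin N → Fin n, (1 / (n : ℝ)) ^ N *
    ∏ st : Fin n × Fin n with st.1 ≤ st.2,
      edgeCountMass ℓ p q γ G V st.1 st.2 (numBlockEdges V st.1 st.2 H) *
        (((blockPairs V st.1 st.2).card.choose (numBlockEdges V st.1 st.2 H) : ℕ) : ℝ)⁻¹

/-- The kernel `R` maps every graph on `Fin n` to a probability distribution on graphs on `Fin N`. -/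
def IsGraphKernel {n N : ℕ} (R : SimpleGraph (Fin n) → SimpleGraph (Fin N) → ℝ) : Prop :=
  ∀ G, IsProbMass (R G)

/-- The test `G ↦ φ(G̃)`, where `G̃` is the output of the randomized reduction on input `G`. -/
def reducedTest {n N : ℕ} (ℓ : ℕ) (p q γ : ℝ) (φ : SimpleGraph (Fin N) → Bool) :
    SimpleGraph (Fin n) → Bool → ℝ :=
  compTest (reductionMass ℓ p q γ) φ

/-- The loss `ξ` of the reduction, where `K = k ℓ`. -/
def xiBound (ℓ k : ℕ) (q γ : ℝ) : ℝ :=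
  Real.exp (-((k * ℓ : ℕ) : ℝ) / 12) + 1.5 * k * Real.exp (-(ℓ : ℝ) / 18)
    + 2 * (k : ℝ) ^ 2 * (8 * q * (ℓ : ℝ) ^ 2) ^ (mZero γ + 1)
    + 0.5 * √(Real.exp (72 * Real.exp 1 ^ 2 * q * (ℓ : ℝ) ^ 2) - 1)
    + √(0.5 * k) * Real.exp (-(ℓ : ℝ) / 36)

end

noncomputable section

open Finset

/-! ### Binomial mass functions -/

/-! The laws `P'` and `Q'` are tuned so that `γ P' + (1 - γ) Q' = Q`. Averaging over an Erdős–Rényi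
input therefore makes every block binomial with parameter `q`, so the output is exactly `𝒢(N, q)`
and the Type-I error does not change. The price is that `P'` is only close to `P = Binom(L, 2q)`:
the ratio `P(m) / Q(m)` is at most `2 ^ m`, so `γ P ≤ Q` is guaranteed up to `m₀`, and beyond it `P`
is replaced by `Q / γ`. Since `16 q ℓ² ≤ 1`, the tails are small enough for `P'` and `Q'` to be
nonnegative and for `P'` to be within `2 (2Lq) ^ (m₀ + 1)` of `P` in `ℓ¹`.

For the Type-II error fix the clique `C` and let `S` be the set of vertices with parent in `C`.
Three laws are compared. In the true output, blocks between distinct parents in `C` follow `P'` if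
both parents have at most `2ℓ` children. In the multipartite law, edges inside `S` have probability
`2q`, except for sibling pairs, which keep probability `q`. In the dense law, all pairs inside `S`
have probability `2q`; averaged over the parents this is the planted dense subgraph model, since `S`
is a random set with inclusion probability `k / n = K / N`.

The first two laws are compared block by block in `ℓ¹`, outside the event that some parent in `C`
has more than `2ℓ` children (`sum_uniform_blockMass_sub_multipartite_le`). For the last two, the
parents of `S` given `S` are uniform on `C`, so the multipartite law is a mixture and the second
moment method applies (`sum_mul_multipartite_sub_dense_le`). The second moment is at most the mean
of `(1 + q)` to the number of pairs that are siblings under two independent assignments. These pairs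
live in `k²` boxes, and negative association of the occupation numbers (`sum_prod_occupation_le`)
bounds the mean by a product of binomial expectations, in total `exp (4 q ℓ²)`. This requires `#S ≤
2kℓ`, which fails with probability at most `exp (-kℓ / 12)`. -/

theorem binomMass_nonneg {r : ℝ} (h0 : 0 ≤ r) (h1 : r ≤ 1) (L m : ℕ) : 0 ≤ binomMass L r m := by
  have : 0 ≤ 1 - r := by linarith
  unfold binomMass; positivity

theorem binomMass_of_lt {L m : ℕ} (h : L < m) (r : ℝ) : binomMass L r m = 0 := by
  simp [binomMass, Nat.choose_eq_zero_of_lt h]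

theorem sum_binomMass (L : ℕ) (r : ℝ) : ∑ m ∈ range (L + 1), binomMass L r m = 1 := by
  have h := add_pow r (1 - r) L
  rw [add_sub_cancel, one_pow] at h
  rw [h]
  exact sum_congr rfl fun m _ => by unfold binomMass; ring

theorem isProbMassUpTo_binomMass {r : ℝ} (h0 : 0 ≤ r) (h1 : r ≤ 1) (L : ℕ) :
    IsProbMassUpTo L (binomMass L r) :=
  ⟨fun m _ => binomMass_nonneg h0 h1 L m, fun _ hm => binomMass_of_lt hm r, sum_binomMass L r⟩

theorem IsProbMassUpTo.nonneg {L : ℕ} {μ : ℕ → ℝ} (h : IsProbMassUpTo L μ) (m : ℕ) : 0 ≤ μ m := by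
  rcases le_or_gt m L with hm | hm
  · exact h.1 m hm
  · exact (h.2.1 m hm).ge

/-- The factor `1 / 2` comes from `m! ≥ 2`; it will cancel the factor `1 / (1 - x) ≤ 2` of a
geometric tail. -/
theorem binomMass_le_pow {r : ℝ} (h0 : 0 ≤ r) (h1 : r ≤ 1) (L : ℕ) {m : ℕ} (hm : 2 ≤ m) :
    binomMass L r m ≤ (L * r) ^ m / 2 := by
  have hch : (L.choose m : ℝ) ≤ (L : ℝ) ^ m / m.factorial := Nat.choose_le_pow_div m L
  have hfac : (2 : ℝ) ≤ m.factorial := by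
    exact_mod_cast hm.trans (Nat.self_le_factorial m)
  have hch' : (L.choose m : ℝ) ≤ (L : ℝ) ^ m / 2 :=
    hch.trans (div_le_div_of_nonneg_left (by positivity) (by norm_num) hfac)
  have hone : (1 - r) ^ (L - m) ≤ 1 := pow_le_one₀ (by linarith) (by linarith)
  calc binomMass L r m ≤ (L.choose m : ℝ) * r ^ m * 1 := by
        unfold binomMass
        gcongr
    _ ≤ (L : ℝ) ^ m / 2 * r ^ m := by
        rw [mul_one]; gcongr
    _ = (L * r) ^ m / 2 := by ring

theorem one_sub_mul_le_binomMass_zero {r : ℝ} (h1 : r ≤ 1) (L : ℕ) :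
    1 - L * r ≤ binomMass L r 0 := by
  have := one_add_mul_le_pow (a := -r) (by linarith) L
  simp only [binomMass, Nat.choose_zero_right, Nat.cast_one, pow_zero, one_mul, Nat.sub_zero]
  calc 1 - L * r = 1 + L * (-r) := by ring
    _ ≤ (1 + -r) ^ L := this
    _ = (1 - r) ^ L := by ring

/-! ### The modified mass functions -/

theorem two_pow_mZero_le {γ : ℝ} (h0 : 0 < γ) (h1 : γ ≤ 1 / 2) : (2 : ℝ) ^ mZero γ ≤ 1 / γ := by
  have hpos : 0 < 1 / γ := by positivity
  have hlog : 0 ≤ Real.logb 2 (1 / γ) :=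
    Real.logb_nonneg (by norm_num) (by rw [le_div_iff₀ h0]; linarith)
  have := Nat.floor_le hlog
  rw [Real.le_logb_iff_rpow_le (by norm_num) hpos, Real.rpow_natCast] at this
  exact this

theorem lt_two_pow_mZero_succ {γ : ℝ} (h0 : 0 < γ) : 1 / γ < (2 : ℝ) ^ (mZero γ + 1) := by
  have hpos : 0 < 1 / γ := by positivity
  have := Nat.lt_floor_add_one (Real.logb 2 (1 / γ))
  rw [Real.logb_lt_iff_lt_rpow (by norm_num) hpos] at this
  exact_mod_cast this

theorem one_le_mZero {γ : ℝ} (h0 : 0 < γ) (h1 : γ ≤ 1 / 2) : 1 ≤ mZero γ := by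
  apply Nat.le_floor
  rw [Real.le_logb_iff_rpow_le (by norm_num) (by positivity), le_div_iff₀ h0]
  norm_num; linarith

theorem sum_Ioc_pow_le {x : ℝ} (h0 : 0 ≤ x) (h1 : x ≤ 1 / 2) (m L : ℕ) :
    ∑ j ∈ Ioc m L, x ^ j / 2 ≤ x ^ (m + 1) := by
  have hI : Ioc m L = Ico (m + 1) (L + 1) := by ext; simp
  have h := geom_sum_Ico_le_of_lt_one (m := m + 1) (n := L + 1) h0 (by linarith)
  rw [← sum_div, hI]
  have h2 : x ^ (m + 1) / (1 - x) ≤ x ^ (m + 1) * 2 := by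
    rw [div_le_iff₀ (by linarith)]
    nlinarith [pow_nonneg h0 (m + 1)]
  linarith

section PrimeMass

variable {q γ : ℝ} {L : ℕ}

theorem binomMass_two_mul_le (hq0 : 0 ≤ q) (hq : q ≤ 1 / 16)
    {m : ℕ} (hm : 2 ≤ m) : binomMass L (2 * q) m ≤ (2 * L * q) ^ m / 2 := by
  refine (binomMass_le_pow (by linarith) (by linarith) L hm).trans_eq ?_
  ring

/-- Beyond `m₀` the factor `1 / γ` is below `2 ^ m`, so it is absorbed by doubling `q`: the two
competing tails obey the same bound. -/
theorem inv_mul_binomMass_le (hq0 : 0 ≤ q) (hq : q ≤ 1 / 16) (hγ0 : 0 < γ) (hγ : γ ≤ 1 / 2)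
    {m : ℕ} (hm : mZero γ < m) : 1 / γ * binomMass L q m ≤ (2 * L * q) ^ m / 2 := by
  have h2 : 2 ≤ m := by have := one_le_mZero hγ0 hγ; omega
  have hγm : 1 / γ ≤ 2 ^ m :=
    (lt_two_pow_mZero_succ hγ0).le.trans (pow_le_pow_right₀ (by norm_num) hm)
  calc 1 / γ * binomMass L q m ≤ 2 ^ m * ((L * q) ^ m / 2) :=
        mul_le_mul hγm (binomMass_le_pow hq0 (by linarith) L h2)
          (binomMass_nonneg hq0 (by linarith) L m) (by positivity)
    _ = (2 * L * q) ^ m / 2 := by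
        rw [mul_assoc 2, mul_pow 2]; ring

theorem sum_pPrimeMass (p q γ : ℝ) (L : ℕ) :
    ∑ m ∈ range (L + 1), pPrimeMass p q γ L m = 1 := by
  rw [← sum_binomMass L p, sum_range_succ', sum_range_succ' (binomMass L p)]
  have h0 : pPrimeMass p q γ L 0 = binomMass L p 0 +
      ∑ j ∈ range L, if mZero γ < j + 1 then
        (binomMass L p (j + 1) - 1 / γ * binomMass L q (j + 1)) else 0 := by
    rw [← sum_filter, pPrimeMass, if_pos rfl]
    congr 1
    refine sum_nbij' (fun j => j - 1) (fun j => j + 1) ?_ ?_ ?_ ?_ ?_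
    · intro j hj; simp at hj ⊢; omega
    · intro j hj; simp at hj ⊢; omega
    · intro j hj; simp at hj ⊢; omega
    · intro j hj; simp
    · intro j hj
      have : j - 1 + 1 = j := by simp at hj; omega
      simp [this]
  rw [h0, ← add_assoc, add_right_comm, ← sum_add_distrib]
  congr 1
  refine sum_congr rfl fun j _ => ?_
  simp only [pPrimeMass, Nat.succ_ne_zero, if_false]
  split_ifs <;> first | omega | ring

theorem pPrimeMass_of_lt {p q γ : ℝ} {L m : ℕ} (h : L < m) : pPrimeMass p q γ L m = 0 := by
  have : m ≠ 0 := by omega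
  simp [pPrimeMass, this, binomMass_of_lt h]

theorem sum_Ioc_binomMass_two_mul_le (hq0 : 0 ≤ q) (hq : q ≤ 1 / 16) (hγ0 : 0 < γ)
    (hγ : γ ≤ 1 / 2) (hL : 4 * L * q ≤ 1) :
    ∑ j ∈ Ioc (mZero γ) L, binomMass L (2 * q) j ≤ (2 * L * q) ^ (mZero γ + 1) := by
  refine le_trans (sum_le_sum fun j hj => ?_) (sum_Ioc_pow_le (by positivity) (by linarith) _ _)
  exact binomMass_two_mul_le hq0 hq (by
    have := one_le_mZero hγ0 hγ
    have := (mem_Ioc.1 hj).1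
    omega)

theorem sum_Ioc_inv_mul_binomMass_le (hq0 : 0 ≤ q) (hq : q ≤ 1 / 16) (hγ0 : 0 < γ)
    (hγ : γ ≤ 1 / 2) (hL : 4 * L * q ≤ 1) :
    ∑ j ∈ Ioc (mZero γ) L, 1 / γ * binomMass L q j ≤ (2 * L * q) ^ (mZero γ + 1) :=
  le_trans (sum_le_sum fun _ hj => inv_mul_binomMass_le hq0 hq hγ0 hγ (mem_Ioc.1 hj).1)
    (sum_Ioc_pow_le (by positivity) (by linarith) _ _)

theorem isProbMassUpTo_pPrimeMass (hq0 : 0 ≤ q) (hq : q ≤ 1 / 16) (hγ0 : 0 < γ) (hγ : γ ≤ 1 / 2)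
    (hL : 4 * L * q ≤ 1) : IsProbMassUpTo L (pPrimeMass (2 * q) q γ L) := by
  refine ⟨fun m _ => ?_, fun m hm => pPrimeMass_of_lt hm, sum_pPrimeMass _ _ _ _⟩
  unfold pPrimeMass
  split_ifs with h1 h2
  -- `P(0) ≥ 1 - 2Lq`, and the mass removed is at most `(2Lq) ^ (m₀ + 1) ≤ 2Lq`; what remains is at
  -- least `1 - 4Lq ≥ 0`.
  · have hP := one_sub_mul_le_binomMass_zero (r := 2 * q) (by linarith) L
    have hsum := sum_Ioc_inv_mul_binomMass_le hq0 hq hγ0 hγ hL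
    have hx0 : 0 ≤ 2 * L * q := by positivity
    have hpow : (2 * L * q) ^ (mZero γ + 1) ≤ 2 * L * q :=
      pow_le_of_le_one hx0 (by linarith) (by omega)
    have hnn : 0 ≤ ∑ j ∈ Ioc (mZero γ) L, binomMass L (2 * q) j :=
      sum_nonneg fun j _ => binomMass_nonneg (by linarith) (by linarith) L j
    rw [sum_sub_distrib]
    linarith
  · exact binomMass_nonneg (by linarith) (by linarith) L m
  · exact mul_nonneg (by positivity) (binomMass_nonneg hq0 (by linarith) L m)

/-- This likelihood ratio bound explains the cutoff: `2 ^ m ≤ 1 / γ` holds exactly for `m ≤ m₀`. -/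
theorem binomMass_two_mul_le_two_pow_mul (hq0 : 0 ≤ q) (hq : q ≤ 1 / 16) (L m : ℕ) :
    binomMass L (2 * q) m ≤ 2 ^ m * binomMass L q m := by
  unfold binomMass
  have : (1 - 2 * q) ^ (L - m) ≤ (1 - q) ^ (L - m) :=
    pow_le_pow_left₀ (by linarith) (by linarith) _
  calc (L.choose m : ℝ) * (2 * q) ^ m * (1 - 2 * q) ^ (L - m)
      ≤ (L.choose m : ℝ) * (2 * q) ^ m * (1 - q) ^ (L - m) := by gcongr
    _ = _ := by rw [mul_pow]; ring

theorem isProbMassUpTo_qPrimeMass (hq0 : 0 ≤ q) (hq : q ≤ 1 / 16) (hγ0 : 0 < γ) (hγ : γ ≤ 1 / 2)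
    (hL : 4 * L * q ≤ 1) : IsProbMassUpTo L (qPrimeMass (2 * q) q γ L) := by
  have hP := isProbMassUpTo_pPrimeMass hq0 hq hγ0 hγ hL
  have hγ1 : 0 < 1 - γ := by linarith
  refine ⟨fun m hm => ?_, fun m hm => ?_, ?_⟩
  · refine mul_nonneg (by positivity) (sub_nonneg.2 ?_)
    rcases Nat.eq_zero_or_pos m with rfl | hm0
    -- At `0` crude bounds suffice: `γ P'(0) ≤ 1 / 2`, while `Q(0) ≥ 1 - Lq ≥ 3 / 4`.
    · have h1 : pPrimeMass (2 * q) q γ L 0 ≤ 1 := by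
        rw [← hP.2.2]
        exact single_le_sum (f := pPrimeMass (2 * q) q γ L) (s := range (L + 1))
          (fun j _ => hP.nonneg j) (by simp)
      have h2 := one_sub_mul_le_binomMass_zero (r := q) (by linarith) L
      have := mul_le_mul_of_nonneg_left h1 hγ0.le
      linarith
    · rw [pPrimeMass, if_neg hm0.ne']
      split_ifs with h
      · have h1 : (2 : ℝ) ^ m ≤ 1 / γ :=
          (pow_le_pow_right₀ (by norm_num) h).trans (two_pow_mZero_le hγ0 hγ)
        have h2 := binomMass_two_mul_le_two_pow_mul hq0 hq L m
        have h3 := binomMass_nonneg hq0 (by linarith) L m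
        calc γ * binomMass L (2 * q) m ≤ γ * (1 / γ * binomMass L q m) := by
              gcongr
              exact h2.trans (by gcongr)
          _ = binomMass L q m := by field_simp
      · exact le_of_eq (by field_simp)
  · simp [qPrimeMass, binomMass_of_lt hm, pPrimeMass_of_lt hm]
  · unfold qPrimeMass
    rw [← mul_sum, sum_sub_distrib, ← mul_sum, sum_binomMass, sum_pPrimeMass]
    field_simp

/-- The two laws differ only beyond `m₀` and at `0`, where the tail difference is compensated. Each
contribution is at most one power because both tails are nonnegative and satisfy the same bound. -/
theorem sum_abs_pPrimeMass_sub_le (hq0 : 0 ≤ q) (hq : q ≤ 1 / 16) (hγ0 : 0 < γ) (hγ : γ ≤ 1 / 2)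
    (hL : 4 * L * q ≤ 1) :
    ∑ m ∈ range (L + 1), |pPrimeMass (2 * q) q γ L m - binomMass L (2 * q) m|
      ≤ 2 * (2 * L * q) ^ (mZero γ + 1) := by
  have hsub : ∑ m ∈ range (L + 1), |pPrimeMass (2 * q) q γ L m - binomMass L (2 * q) m|
      ≤ ∑ m ∈ insert 0 (Ioc (mZero γ) L),
        |pPrimeMass (2 * q) q γ L m - binomMass L (2 * q) m| := by
    rw [← sum_filter_of_ne (p := fun m => m ∈ insert 0 (Ioc (mZero γ) L))]
    · exact sum_le_sum_of_subset_of_nonneg (fun m hm => (mem_filter.1 hm).2)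
        fun _ _ _ => abs_nonneg _
    · intro m hm hne
      by_contra hcon
      refine hne ?_
      simp at hcon hm
      rw [pPrimeMass, if_neg hcon.1, if_pos (by omega), sub_self, abs_zero]
  refine hsub.trans ?_
  rw [sum_insert (by simp), two_mul (_ ^ (mZero γ + 1))]
  have hA := sum_Ioc_binomMass_two_mul_le hq0 hq hγ0 hγ hL
  have hB := sum_Ioc_inv_mul_binomMass_le hq0 hq hγ0 hγ hL
  have hA0 : 0 ≤ ∑ j ∈ Ioc (mZero γ) L, binomMass L (2 * q) j :=
    sum_nonneg fun j _ => binomMass_nonneg (by linarith) (by linarith) L j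
  have hB0 : 0 ≤ ∑ j ∈ Ioc (mZero γ) L, 1 / γ * binomMass L q j :=
    sum_nonneg fun j _ => mul_nonneg (by positivity) (binomMass_nonneg hq0 (by linarith) L j)
  refine add_le_add ?_ ?_
  · rw [pPrimeMass, if_pos rfl, add_sub_cancel_left, sum_sub_distrib, abs_le]
    constructor <;> linarith
  · refine le_trans (sum_le_sum fun m hm => ?_)
      (sum_Ioc_pow_le (x := 2 * L * q) (by positivity) (by linarith) (mZero γ) L)
    have hm' := (mem_Ioc.1 hm).1
    rw [pPrimeMass, if_neg (by omega), if_neg (by omega), abs_le]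
    have h1 := inv_mul_binomMass_le (L := L) hq0 hq hγ0 hγ hm'
    have h2 := binomMass_two_mul_le (L := L) hq0 hq (m := m)
      (by have := one_le_mZero hγ0 hγ; omega)
    have h3 := binomMass_nonneg (r := 2 * q) (by linarith) (by linarith) L m
    have h4 : 0 ≤ 1 / γ * binomMass L q m :=
      mul_nonneg (by positivity) (binomMass_nonneg hq0 (by linarith) L m)
    constructor <;> linarith

end PrimeMass

/-! ### Sums over the subsets of a union of disjoint blocks -/

section Blocks

variable {α β : Type*} [DecidableEq α]

theorem sum_powerset_union_of_disjoint {X Y : Finset α} (h : Disjoint X Y) (f : Finset α → ℝ) :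
    ∑ A ∈ (X ∪ Y).powerset, f A = ∑ A ∈ X.powerset, ∑ B ∈ Y.powerset, f (A ∪ B) := by
  rw [← sum_product']
  symm
  refine sum_nbij' (fun p => p.1 ∪ p.2) (fun A => (A ∩ X, A ∩ Y)) ?_ ?_ ?_ ?_ ?_
  · rintro ⟨A, B⟩ hp
    simp only [mem_product, mem_powerset] at hp ⊢
    exact union_subset_union hp.1 hp.2
  · intro A _
    simp
  · rintro ⟨A, B⟩ hp
    simp only [mem_product, mem_powerset] at hp
    have h1 : B ∩ X = ∅ := disjoint_iff_inter_eq_empty.1 (h.symm.mono_left hp.2)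
    have h2 : A ∩ Y = ∅ := disjoint_iff_inter_eq_empty.1 (h.mono_left hp.1)
    simp [union_inter_distrib_right, h1, h2, inter_eq_left.2 hp.1, inter_eq_left.2 hp.2]
  · intro A hA
    rw [mem_powerset] at hA
    simp only
    rw [← inter_union_distrib_left, inter_eq_left.2 hA]
  · intros; rfl

theorem union_inter_of_subset_of_disjoint {A B X Z : Finset α} (hB : B ⊆ Z) (h : Disjoint X Z) :
    (A ∪ B) ∩ X = A ∩ X := by
  rw [union_inter_distrib_right, disjoint_iff_inter_eq_empty.1 (h.symm.mono_left hB), union_empty]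

theorem prod_union_inter {I : Finset β} {b : β} {B : β → Finset α} {A A' : Finset α}
    (hA : A ⊆ B b) (hd : ∀ c ∈ I, Disjoint (B b) (B c))
    (F : β → Finset α → ℝ) :
    ∏ c ∈ I, F c ((A ∪ A') ∩ B c) = ∏ c ∈ I, F c (A' ∩ B c) :=
  prod_congr rfl fun c hc => by
    rw [union_comm, union_inter_of_subset_of_disjoint hA (hd c hc).symm]

theorem union_inter_block {I : Finset β} {b : β} {B : β → Finset α} {A A' : Finset α}
    (hA : A ⊆ B b) (hA' : A' ⊆ I.biUnion B) (hd : Disjoint (B b) (I.biUnion B)) :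
    (A ∪ A') ∩ B b = A := by
  rw [union_inter_of_subset_of_disjoint hA' hd, inter_eq_left.2 hA]

variable [DecidableEq β]

theorem sum_powerset_biUnion_prod (I : Finset β) (B : β → Finset α)
    (hd : (I : Set β).PairwiseDisjoint B) (F : β → Finset α → ℝ) :
    ∑ A ∈ (I.biUnion B).powerset, ∏ b ∈ I, F b (A ∩ B b)
      = ∏ b ∈ I, ∑ A ∈ (B b).powerset, F b A := by
  induction I using Finset.induction_on with
  | empty => simp
  | insert b I hb ih =>
    have hdI : ∀ c ∈ I, Disjoint (B b) (B c) := fun c hc =>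
      hd (by simp) (by simp [hc]) (fun h => hb (h ▸ hc))
    have hdU : Disjoint (B b) (I.biUnion B) := (disjoint_biUnion_right _ _ _).2 hdI
    rw [biUnion_insert, sum_powerset_union_of_disjoint hdU, prod_insert hb,
      ← ih (hd.subset (by simp)), sum_mul_sum]
    refine sum_congr rfl fun A hA => sum_congr rfl fun A' hA' => ?_
    rw [mem_powerset] at hA hA'
    rw [prod_insert hb, union_inter_block hA hA' hdU, prod_union_inter hA hdI]

/-- Subadditivity of the `ℓ¹` distance for product laws: exchange the factors one block at a time,
using that all the other factors have total mass one. -/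
theorem sum_powerset_biUnion_abs_sub_le (I : Finset β) (B : β → Finset α)
    (hd : (I : Set β).PairwiseDisjoint B) (F F' : β → Finset α → ℝ)
    (hF : ∀ b ∈ I, ∀ A, 0 ≤ F b A) (hF' : ∀ b ∈ I, ∀ A, 0 ≤ F' b A)
    (hsF : ∀ b ∈ I, ∑ A ∈ (B b).powerset, F b A = 1)
    (hsF' : ∀ b ∈ I, ∑ A ∈ (B b).powerset, F' b A = 1) :
    ∑ A ∈ (I.biUnion B).powerset, |∏ b ∈ I, F b (A ∩ B b) - ∏ b ∈ I, F' b (A ∩ B b)|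
      ≤ ∑ b ∈ I, ∑ A ∈ (B b).powerset, |F b A - F' b A| := by
  induction I using Finset.induction_on with
  | empty => simp
  | insert b I hb ih =>
    have hdI : ∀ c ∈ I, Disjoint (B b) (B c) := fun c hc =>
      hd (by simp) (by simp [hc]) (fun h => hb (h ▸ hc))
    have hdU : Disjoint (B b) (I.biUnion B) := (disjoint_biUnion_right _ _ _).2 hdI
    have hdd : (I : Set β).PairwiseDisjoint B := hd.subset (by simp)
    have hIH := ih hdd (fun c hc => hF c (mem_insert_of_mem hc))
      (fun c hc => hF' c (mem_insert_of_mem hc)) (fun c hc => hsF c (mem_insert_of_mem hc))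
      (fun c hc => hsF' c (mem_insert_of_mem hc))
    have hone : ∑ A ∈ (I.biUnion B).powerset, ∏ c ∈ I, F' c (A ∩ B c) = 1 := by
      rw [sum_powerset_biUnion_prod I B hdd]
      exact prod_eq_one fun c hc => hsF' c (mem_insert_of_mem hc)
    rw [biUnion_insert, sum_powerset_union_of_disjoint hdU, sum_insert hb]
    calc _ ≤ ∑ A ∈ (B b).powerset, ∑ A' ∈ (I.biUnion B).powerset,
          (F b A * |∏ c ∈ I, F c (A' ∩ B c) - ∏ c ∈ I, F' c (A' ∩ B c)|
            + |F b A - F' b A| * ∏ c ∈ I, F' c (A' ∩ B c)) := by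
          refine sum_le_sum fun A hA => sum_le_sum fun A' hA' => ?_
          rw [mem_powerset] at hA hA'
          rw [prod_insert hb, prod_insert hb, union_inter_block hA hA' hdU,
            prod_union_inter hA hdI, prod_union_inter hA hdI]
          have h1 := hF b (mem_insert_self b I) A
          have h2 : 0 ≤ ∏ c ∈ I, F' c (A' ∩ B c) :=
            prod_nonneg fun c hc => hF' c (mem_insert_of_mem hc) _
          generalize ∏ c ∈ I, F' c (A' ∩ B c) = y at *
          generalize ∏ c ∈ I, F c (A' ∩ B c) = z at *
          calc |F b A * z - F' b A * y| = |F b A * (z - y) + (F b A - F' b A) * y| := by ring_nf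
            _ ≤ |F b A * (z - y)| + |(F b A - F' b A) * y| := abs_add_le _ _
            _ = _ := by rw [abs_mul, abs_mul, abs_of_nonneg h1, abs_of_nonneg h2]
      _ = (∑ A' ∈ (I.biUnion B).powerset,
              |∏ c ∈ I, F c (A' ∩ B c) - ∏ c ∈ I, F' c (A' ∩ B c)|)
            + ∑ A ∈ (B b).powerset, |F b A - F' b A| := by
          simp only [sum_add_distrib, ← mul_sum, ← sum_mul]
          rw [hone, hsF b (mem_insert_self b I), one_mul, mul_one]
      _ ≤ _ := by linarith

end Blocks

/-- The mass of the set `A ⊆ B` when its size has law `c` and, given its size, it is uniform. -/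
def sizeMass {α : Type*} (B : Finset α) (c : ℕ → ℝ) (A : Finset α) : ℝ :=
  c A.card * ((B.card.choose A.card : ℕ) : ℝ)⁻¹

/-- There are `choose` many sets of each size `m`, so a summand homogeneous in the uniform weight
collapses to a sum over sizes. The function `g` covers both the total mass and the `ℓ¹` distance. -/
theorem sum_powerset_sizeMass_apply {α : Type*} (B : Finset α) (c : ℕ → ℝ) (g : ℕ → ℝ → ℝ)
    (hg : ∀ m ∈ range (B.card + 1), ∀ a : ℝ, 0 < a → a * g m a⁻¹ = c m) :
    ∑ A ∈ B.powerset, g A.card ((B.card.choose A.card : ℕ) : ℝ)⁻¹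
      = ∑ m ∈ range (B.card + 1), c m := by
  rw [sum_powerset_apply_card (fun m => g m ((B.card.choose m : ℕ) : ℝ)⁻¹)]
  refine sum_congr rfl fun m hm => ?_
  rw [nsmul_eq_mul]
  exact hg m hm _ (by
    exact_mod_cast Nat.choose_pos (by simpa [Nat.lt_succ_iff] using hm))

theorem sum_powerset_sizeMass {α : Type*} (B : Finset α) (c : ℕ → ℝ) :
    ∑ A ∈ B.powerset, sizeMass B c A = ∑ m ∈ range (B.card + 1), c m :=
  sum_powerset_sizeMass_apply B c (fun m a => c m * a) fun m _ a ha => by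
    field_simp

theorem sum_powerset_abs_sizeMass_sub {α : Type*} (B : Finset α) (c c' : ℕ → ℝ) :
    ∑ A ∈ B.powerset, |sizeMass B c A - sizeMass B c' A|
      = ∑ m ∈ range (B.card + 1), |c m - c' m| :=
  sum_powerset_sizeMass_apply B _ (fun m a => |c m * a - c' m * a|) fun m _ a ha => by
    rw [← sub_mul, abs_mul, abs_of_pos (inv_pos.2 ha)]
    field_simp

/-- Independent trials with equal success probability are uniform given the number of successes, so
a binomial edge count reproduces independent edges. -/
theorem sizeMass_binomMass {α : Type*} [DecidableEq α] {A B : Finset α} (h : A ⊆ B) (r : ℝ) :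
    sizeMass B (binomMass B.card r) A = ∏ e ∈ B, if e ∈ A then r else 1 - r := by
  have hc : ((B.card.choose A.card : ℕ) : ℝ) ≠ 0 := by
    exact_mod_cast (Nat.choose_pos (card_le_card h)).ne'
  rw [prod_ite, prod_const, prod_const, filter_mem_eq_inter, inter_eq_right.2 h,
    filter_notMem_eq_sdiff, card_sdiff_of_subset h, sizeMass, binomMass]
  field_simp

/-! ### Graphs and their sets of edges -/

open Classical in
/-- The unordered pairs of distinct vertices. -/
def edgePairs (N : ℕ) : Finset (Sym2 (Fin N)) := univ.filter fun e => ¬ e.IsDiag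

open Classical in
/-- The edges of `H`, as a finite set. -/
def edgesOf {N : ℕ} (H : SimpleGraph (Fin N)) : Finset (Sym2 (Fin N)) :=
  univ.filter fun e => e ∈ H.edgeSet

theorem mem_edgesOf {N : ℕ} {H : SimpleGraph (Fin N)} {e : Sym2 (Fin N)} :
    e ∈ edgesOf H ↔ e ∈ H.edgeSet := by
  simp [edgesOf]

theorem mem_edgePairs {N : ℕ} {e : Sym2 (Fin N)} : e ∈ edgePairs N ↔ ¬ e.IsDiag := by
  simp [edgePairs]

theorem edgesOf_subset {N : ℕ} (H : SimpleGraph (Fin N)) : edgesOf H ⊆ edgePairs N :=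
  fun _ he => mem_edgePairs.2 (H.not_isDiag_of_mem_edgeSet (mem_edgesOf.1 he))

theorem sum_graph_eq_sum_powerset {N : ℕ} (g : Finset (Sym2 (Fin N)) → ℝ) :
    ∑ H : SimpleGraph (Fin N), g (edgesOf H) = ∑ A ∈ (edgePairs N).powerset, g A := by
  refine sum_nbij' edgesOf (fun A => SimpleGraph.fromEdgeSet (A : Set (Sym2 (Fin N)))) ?_ ?_ ?_ ?_ ?_
  · intro H _
    exact mem_powerset.2 (edgesOf_subset H)
  · intro A _
    exact mem_univ _
  · intro H _
    have : ((edgesOf H : Finset _) : Set (Sym2 (Fin N))) = H.edgeSet := by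
      ext; simp [mem_edgesOf]
    simp only [this, SimpleGraph.fromEdgeSet_edgeSet]
  · intro A hA
    ext e
    rw [mem_edgesOf, SimpleGraph.edgeSet_fromEdgeSet]
    have := mem_powerset.1 hA
    constructor
    · intro h; exact h.1
    · intro h
      exact ⟨h, fun h' => mem_edgePairs.1 (this h) (by simpa using h')⟩
  · intros; rfl

theorem indepEdgeMass_eq {N : ℕ} (w : Sym2 (Fin N) → ℝ) (H : SimpleGraph (Fin N)) :
    indepEdgeMass N w H = ∏ e ∈ edgePairs N, if e ∈ edgesOf H then w e else 1 - w e := by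
  unfold indepEdgeMass edgePairs
  refine prod_congr (by congr) fun e _ => ?_
  by_cases h : e ∈ H.edgeSet <;> simp [mem_edgesOf, h]

theorem indepEdgeMass_nonneg {N : ℕ} {w : Sym2 (Fin N) → ℝ} (h0 : ∀ e, 0 ≤ w e)
    (h1 : ∀ e, w e ≤ 1) (H : SimpleGraph (Fin N)) : 0 ≤ indepEdgeMass N w H := by
  rw [indepEdgeMass_eq]
  refine prod_nonneg fun e _ => ?_
  split_ifs
  · exact h0 e
  · linarith [h1 e]

theorem sum_prod_ite_mem {N : ℕ} (a b : Sym2 (Fin N) → ℝ) :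
    ∑ H : SimpleGraph (Fin N), ∏ e ∈ edgePairs N, (if e ∈ edgesOf H then a e else b e)
      = ∏ e ∈ edgePairs N, (a e + b e) := by
  rw [sum_graph_eq_sum_powerset (fun A => ∏ e ∈ edgePairs N, (if e ∈ A then a e else b e)),
    prod_add]
  refine sum_congr rfl fun A hA => ?_
  rw [prod_ite, filter_mem_eq_inter, inter_eq_right.2 (mem_powerset.1 hA), filter_notMem_eq_sdiff]

theorem sum_indepEdgeMass {N : ℕ} (w : Sym2 (Fin N) → ℝ) :
    ∑ H : SimpleGraph (Fin N), indepEdgeMass N w H = 1 := by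
  simp only [indepEdgeMass_eq]
  rw [sum_prod_ite_mem]
  exact prod_eq_one fun e _ => by ring

/-! ### The blocks of a parent map -/

/-- The ordered pairs that index the blocks. -/
def blockIndices (n : ℕ) : Finset (Fin n × Fin n) := univ.filter fun st => st.1 ≤ st.2

theorem mem_blockIndices {n : ℕ} {st : Fin n × Fin n} : st ∈ blockIndices n ↔ st.1 ≤ st.2 := by
  simp [blockIndices]

section BlockPairs

variable {n N : ℕ} (V : Fin N → Fin n)

theorem mem_blockPairs {s t : Fin n} {e : Sym2 (Fin N)} :
    e ∈ blockPairs V s t ↔ ¬ e.IsDiag ∧ e.map V = s(s, t) := by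
  simp [blockPairs]

theorem biUnion_blockPairs :
    ((blockIndices n).biUnion fun st => blockPairs V st.1 st.2) = edgePairs N := by
  ext e
  simp only [mem_biUnion, mem_blockIndices, mem_blockPairs, mem_edgePairs, Prod.exists]
  constructor
  · rintro ⟨s, t, _, h, _⟩
    exact h
  · intro h
    induction e using Sym2.ind with
    | _ i j =>
      rcases le_total (V i) (V j) with hij | hij
      · exact ⟨V i, V j, hij, h, by simp⟩
      · exact ⟨V j, V i, hij, h, by simp [Sym2.eq_swap]⟩

theorem pairwiseDisjoint_blockPairs :
    (blockIndices n : Set (Fin n × Fin n)).PairwiseDisjoint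
      fun st => blockPairs V st.1 st.2 := by
  rintro ⟨s, t⟩ hst ⟨s', t'⟩ hst' hne
  rw [Function.onFun, disjoint_left]
  intro e he he'
  rw [mem_blockPairs] at he he'
  have h := he.2.symm.trans he'.2
  simp only [mem_coe, mem_blockIndices] at hst hst'
  apply hne
  rcases Sym2.eq_iff.1 h with ⟨rfl, rfl⟩ | ⟨rfl, rfl⟩
  · rfl
  · simp [le_antisymm hst hst']

theorem prod_edgePairs_eq (f : Sym2 (Fin N) → ℝ) :
    ∏ e ∈ edgePairs N, f e = ∏ st ∈ blockIndices n, ∏ e ∈ blockPairs V st.1 st.2, f e := by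
  rw [← biUnion_blockPairs V, prod_biUnion (pairwiseDisjoint_blockPairs V)]

theorem sum_graph_prod_block (F : Fin n × Fin n → Finset (Sym2 (Fin N)) → ℝ) :
    ∑ H : SimpleGraph (Fin N),
        ∏ st ∈ blockIndices n, F st (edgesOf H ∩ blockPairs V st.1 st.2)
      = ∏ st ∈ blockIndices n, ∑ A ∈ (blockPairs V st.1 st.2).powerset, F st A := by
  rw [sum_graph_eq_sum_powerset fun A =>
      ∏ st ∈ blockIndices n, F st (A ∩ blockPairs V st.1 st.2),
    ← biUnion_blockPairs V, sum_powerset_biUnion_prod _ _ (pairwiseDisjoint_blockPairs V)]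

theorem card_blockPairs_self (t : Fin n) :
    (blockPairs V t t).card = (numChildren V t).choose 2 := by
  classical
  rw [numChildren, ← Sym2.card_image_offDiag]
  congr 1
  ext e
  induction e using Sym2.ind with
  | _ i j =>
    simp only [mem_blockPairs, Sym2.mk_isDiag_iff, Sym2.map_mk, Sym2.eq_iff, or_self,
      mem_image, mem_offDiag, mem_filter, mem_univ, true_and, Prod.exists]
    constructor
    · rintro ⟨h, h1, h2⟩
      exact ⟨i, j, ⟨h1, h2, h⟩, by simp⟩
    · rintro ⟨a, b, ⟨h1, h2, h⟩, hab⟩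
      rcases Sym2.eq_iff.1 hab with ⟨rfl, rfl⟩ | ⟨rfl, rfl⟩
      · exact ⟨h, h1, h2⟩
      · exact ⟨Ne.symm h, h2, h1⟩

theorem card_blockPairs_of_ne {s t : Fin n} (hst : s ≠ t) :
    (blockPairs V s t).card = numChildren V s * numChildren V t := by
  classical
  rw [numChildren, numChildren, ← card_product]
  symm
  refine card_bij (fun p _ => s(p.1, p.2)) ?_ ?_ ?_
  · rintro ⟨i, j⟩ h
    simp only [mem_product, mem_filter, mem_univ, true_and] at h
    simp only [mem_blockPairs, Sym2.mk_isDiag_iff, Sym2.map_mk, h.1, h.2, and_true]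
    rintro rfl
    exact hst (h.1.symm.trans h.2)
  · rintro ⟨i, j⟩ h ⟨i', j'⟩ h' heq
    simp only [mem_product, mem_filter, mem_univ, true_and] at h h'
    rcases Sym2.eq_iff.1 heq with ⟨rfl, rfl⟩ | ⟨rfl, rfl⟩
    · rfl
    · exact absurd (h'.1.symm.trans h.2).symm (by rintro h1; exact hst h1.symm)
  · intro e he
    induction e using Sym2.ind with
    | _ i j =>
      simp only [mem_blockPairs, Sym2.map_mk, Sym2.eq_iff] at he
      rcases he.2 with ⟨h1, h2⟩ | ⟨h1, h2⟩
      · exact ⟨(i, j), by simp [h1, h2], rfl⟩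
      · exact ⟨(j, i), by simp [h1, h2], Sym2.eq_swap⟩

theorem numBlockEdges_eq (s t : Fin n) (H : SimpleGraph (Fin N)) :
    numBlockEdges V s t H = (edgesOf H ∩ blockPairs V s t).card := by
  classical
  rw [numBlockEdges]
  congr 1
  ext e
  simp [mem_edgesOf, and_comm]

end BlockPairs

/-! ### Averaging over the input graph -/

/-- With the identity as parent map, each block of the input graph is one pair or empty, so the
block calculus also applies to `𝒢(n, γ)`. -/
theorem blockPairs_id_self {n : ℕ} (t : Fin n) : blockPairs (id : Fin n → Fin n) t t = ∅ := by
  rw [← card_eq_zero, card_blockPairs_self]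
  simp [numChildren, filter_eq']

theorem blockPairs_id_of_ne {n : ℕ} {s t : Fin n} (h : s ≠ t) :
    blockPairs (id : Fin n → Fin n) s t = {s(s, t)} := by
  ext e
  rw [mem_blockPairs, Sym2.map_id, id, mem_singleton]
  refine ⟨fun he => he.2, ?_⟩
  rintro rfl
  exact ⟨by simpa using h, rfl⟩

open Classical in
theorem sum_erdosRenyiMass_mul_prod {n : ℕ} {γ : ℝ} (h0 : 0 ≤ γ) (h1 : γ ≤ 1)
    (a b : Fin n × Fin n → ℝ) :
    ∑ G : SimpleGraph (Fin n), erdosRenyiMass n γ G *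
        ∏ st ∈ blockIndices n, (if G.Adj st.1 st.2 then a st else b st)
      = ∏ st ∈ blockIndices n,
          if st.1 = st.2 then b st else γ * a st + (1 - γ) * b st := by
  let F : Fin n × Fin n → Finset (Sym2 (Fin n)) → ℝ := fun st A =>
    (∏ e ∈ blockPairs id st.1 st.2, if e ∈ A then γ else 1 - γ) *
      if s(st.1, st.2) ∈ A then a st else b st
  have key : ∀ G : SimpleGraph (Fin n), erdosRenyiMass n γ G *
        ∏ st ∈ blockIndices n, (if G.Adj st.1 st.2 then a st else b st)
      = ∏ st ∈ blockIndices n, F st (edgesOf G ∩ blockPairs id st.1 st.2) := by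
    intro G
    rw [erdosRenyiMass_eq n γ h0 h1, indepEdgeMass_eq, prod_edgePairs_eq id, ← prod_mul_distrib]
    refine prod_congr rfl fun st _ => ?_
    dsimp only [F]
    congr 1
    · refine prod_congr rfl fun e he => ?_
      simp [he]
    · by_cases hst : st.1 = st.2
      · simp [hst, mem_edgesOf]
      · simp [hst, blockPairs_id_of_ne, mem_edgesOf]
  rw [sum_congr rfl fun G _ => key G, sum_graph_prod_block id F]
  refine prod_congr rfl fun st _ => ?_
  dsimp only [F]
  split_ifs with hst
  · simp [hst, blockPairs_id_self]
  · rw [blockPairs_id_of_ne hst, ← insert_empty_eq, sum_powerset_insert (by simp)]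
    simp
    ring

theorem adj_sup_cliqueOn {n : ℕ} (G : SimpleGraph (Fin n)) (C : Finset (Fin n)) (s t : Fin n) :
    (G ⊔ cliqueOn C).Adj s t ↔ G.Adj s t ∨ (s ≠ t ∧ s ∈ C ∧ t ∈ C) := by
  simp [cliqueOn]
  tauto

theorem reductionMass_eq {n N : ℕ} (ℓ : ℕ) (p q γ : ℝ) (G : SimpleGraph (Fin n))
    (H : SimpleGraph (Fin N)) :
    reductionMass ℓ p q γ G H = ∑ V : Fin N → Fin n, (1 / (n : ℝ)) ^ N *
      ∏ st ∈ blockIndices n, sizeMass (blockPairs V st.1 st.2)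
        (edgeCountMass ℓ p q γ G V st.1 st.2) (edgesOf H ∩ blockPairs V st.1 st.2) := by
  simp only [reductionMass, sizeMass, numBlockEdges_eq]
  rfl

open Classical in
/-- The law of the number of edges in a block when the input is `𝒢(n, γ)` with a clique planted
on `C`. -/
def plantedCountMass {n N : ℕ} (ℓ : ℕ) (p q γ : ℝ) (C : Finset (Fin n)) (V : Fin N → Fin n)
    (s t : Fin n) (m : ℕ) : ℝ :=
  if (s ≠ t ∧ s ∈ C ∧ t ∈ C) ∧ max (numChildren V s) (numChildren V t) ≤ 2 * ℓ then
    pPrimeMass p q γ (blockPairs V s t).card m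
  else binomMass (blockPairs V s t).card q m

/-- Given the parents, each block sees a single potential edge of the input. Outside the clique,
averaging over it gives `γ P' + (1 - γ) Q' = Q`; inside, the edge is always present and `P'`
survives. -/
theorem sum_erdosRenyiMass_mul_reductionMass {n N : ℕ} (ℓ : ℕ) (p q : ℝ) {γ : ℝ} (h0 : 0 < γ)
    (h1 : γ < 1) (C : Finset (Fin n)) (H : SimpleGraph (Fin N)) :
    ∑ G, erdosRenyiMass n γ G * reductionMass ℓ p q γ (G ⊔ cliqueOn C) H
      = ∑ V : Fin N → Fin n, (1 / (n : ℝ)) ^ N *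
        ∏ st ∈ blockIndices n, sizeMass (blockPairs V st.1 st.2)
          (plantedCountMass ℓ p q γ C V st.1 st.2) (edgesOf H ∩ blockPairs V st.1 st.2) := by
  classical
  simp only [reductionMass_eq, mul_sum]
  rw [sum_comm]
  refine sum_congr rfl fun V _ => ?_
  simp only [mul_left_comm _ ((1 / (n : ℝ)) ^ N)]
  rw [← mul_sum]
  congr 1
  set f : SimpleGraph (Fin n) → Fin n × Fin n → ℝ := fun G st =>
    sizeMass (blockPairs V st.1 st.2)
        (edgeCountMass ℓ p q γ G V st.1 st.2) (edgesOf H ∩ blockPairs V st.1 st.2) with hf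
  -- The block factor depends on the graph only through one adjacency, so `⊤` and the bare clique
  -- serve as representatives of the two cases.
  have hfG : ∀ G st, f (G ⊔ cliqueOn C) st = if G.Adj st.1 st.2 then f ⊤ st
      else f (cliqueOn C) st := by
    intro G st
    have hadj := adj_sup_cliqueOn G C st.1 st.2
    have hadj' := adj_sup_cliqueOn ⊥ C st.1 st.2
    rw [bot_sup_eq, SimpleGraph.bot_adj, false_or] at hadj'
    simp only [hf, sizeMass, edgeCountMass, hadj, hadj', SimpleGraph.top_adj]
    by_cases hG : G.Adj st.1 st.2
    · simp [hG, hG.ne]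
    · simp [hG]
  have : ∀ G, ∏ st ∈ blockIndices n, f (G ⊔ cliqueOn C) st
      = ∏ st ∈ blockIndices n, if G.Adj st.1 st.2 then f ⊤ st else f (cliqueOn C) st :=
    fun G => prod_congr rfl fun st _ => hfG G st
  change ∑ G, erdosRenyiMass n γ G * ∏ st ∈ blockIndices n, f (G ⊔ cliqueOn C) st = _
  simp only [this]
  rw [sum_erdosRenyiMass_mul_prod h0.le h1.le]
  refine prod_congr rfl fun st _ => ?_
  have hadj' := adj_sup_cliqueOn ⊥ C st.1 st.2
  rw [bot_sup_eq, SimpleGraph.bot_adj, false_or] at hadj'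
  simp only [hf, sizeMass, edgeCountMass, plantedCountMass, hadj', SimpleGraph.top_adj]
  by_cases hst : st.1 = st.2
  · simp [hst, card_blockPairs_self]
  · have hne : (1 - γ) ≠ 0 := by linarith
    by_cases hmax : 2 * ℓ < max (numChildren V st.1) (numChildren V st.2)
    · simp only [hst, hmax, not_le.2 hmax, if_true, if_false, and_false,
        card_blockPairs_of_ne V hst]
      ring
    · by_cases hC : st.1 ∈ C ∧ st.2 ∈ C
      · simp only [hst, hmax, not_lt.1 hmax, hC, if_true, if_false, and_true, ne_eq, not_false_eq_true,
          card_blockPairs_of_ne V hst]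
        ring
      · simp only [hst, hmax, not_lt.1 hmax, hC, if_true, if_false, and_true, ne_eq,
          not_false_eq_true, card_blockPairs_of_ne V hst, and_false, qPrimeMass]
        field_simp
        ring

/-! ### The reduction is a kernel -/

theorem sizeMass_nonneg {α : Type*} {B : Finset α} {c : ℕ → ℝ} (hc : ∀ m, 0 ≤ c m)
    (A : Finset α) : 0 ≤ sizeMass B c A :=
  mul_nonneg (hc _) (by positivity)

theorem four_mul_mul_le_one {ℓ a b : ℕ} {q : ℝ} (hq0 : 0 ≤ q) (hqℓ : 16 * q * (ℓ : ℝ) ^ 2 ≤ 1)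
    (ha : a ≤ 2 * ℓ) (hb : b ≤ 2 * ℓ) : 4 * ((a * b : ℕ) : ℝ) * q ≤ 1 := by
  have h : ((a * b : ℕ) : ℝ) ≤ ((2 * ℓ * (2 * ℓ) : ℕ) : ℝ) := by
    exact_mod_cast Nat.mul_le_mul ha hb
  calc 4 * ((a * b : ℕ) : ℝ) * q ≤ 4 * ((2 * ℓ * (2 * ℓ) : ℕ) : ℝ) * q := by gcongr
    _ = 16 * q * (ℓ : ℝ) ^ 2 := by push_cast; ring
    _ ≤ 1 := hqℓ

theorem le_one_div_sixteen {ℓ : ℕ} (hℓ : 1 ≤ ℓ) {q : ℝ} (hq0 : 0 ≤ q)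
    (hqℓ : 16 * q * (ℓ : ℝ) ^ 2 ≤ 1) : q ≤ 1 / 16 := by
  have : (1 : ℝ) ≤ (ℓ : ℝ) ^ 2 := one_le_pow₀ (by exact_mod_cast hℓ)
  nlinarith

section Kernel

variable {ℓ n N : ℕ} {q γ : ℝ}

theorem isProbMassUpTo_edgeCountMass (hℓ : 1 ≤ ℓ) (hq0 : 0 ≤ q) (hqℓ : 16 * q * (ℓ : ℝ) ^ 2 ≤ 1)
    (hγ0 : 0 < γ) (hγ : γ ≤ 1 / 2) (G : SimpleGraph (Fin n)) (V : Fin N → Fin n) (s t : Fin n) :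
    IsProbMassUpTo (blockPairs V s t).card (edgeCountMass ℓ (2 * q) q γ G V s t) := by
  have hq := le_one_div_sixteen hℓ hq0 hqℓ
  by_cases hst : s = t
  · subst hst
    have h : edgeCountMass ℓ (2 * q) q γ G V s s = binomMass ((numChildren V s).choose 2) q :=
      funext fun m => by simp [edgeCountMass]
    rw [h, card_blockPairs_self]
    exact isProbMassUpTo_binomMass hq0 (by linarith) _
  rw [card_blockPairs_of_ne V hst]
  unfold edgeCountMass
  simp only [if_neg hst]
  split_ifs with h1 h2
  · exact isProbMassUpTo_binomMass hq0 (by linarith) _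
  all_goals
    rw [not_lt, max_le_iff] at h1
    have hL := four_mul_mul_le_one hq0 hqℓ h1.1 h1.2
  · exact isProbMassUpTo_pPrimeMass hq0 hq hγ0 hγ hL
  · exact isProbMassUpTo_qPrimeMass hq0 hq hγ0 hγ hL

theorem isProbMassUpTo_plantedCountMass (hℓ : 1 ≤ ℓ) (hq0 : 0 ≤ q)
    (hqℓ : 16 * q * (ℓ : ℝ) ^ 2 ≤ 1) (hγ0 : 0 < γ) (hγ : γ ≤ 1 / 2) (C : Finset (Fin n))
    (V : Fin N → Fin n) (s t : Fin n) :
    IsProbMassUpTo (blockPairs V s t).card (plantedCountMass ℓ (2 * q) q γ C V s t) := by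
  have hq := le_one_div_sixteen hℓ hq0 hqℓ
  unfold plantedCountMass
  split_ifs with h
  · obtain ⟨⟨hst, -, -⟩, hmax⟩ := h
    rw [max_le_iff] at hmax
    rw [card_blockPairs_of_ne V hst]
    exact isProbMassUpTo_pPrimeMass hq0 hq hγ0 hγ (four_mul_mul_le_one hq0 hqℓ hmax.1 hmax.2)
  · exact isProbMassUpTo_binomMass hq0 (by linarith) _

/-- The block product of size-determined masses. -/
def blockMass (V : Fin N → Fin n) (c : Fin n → Fin n → ℕ → ℝ) (H : SimpleGraph (Fin N)) : ℝ :=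
  ∏ st ∈ blockIndices n, sizeMass (blockPairs V st.1 st.2) (c st.1 st.2)
    (edgesOf H ∩ blockPairs V st.1 st.2)

theorem isProbMass_blockMass {V : Fin N → Fin n} {c : Fin n → Fin n → ℕ → ℝ}
    (hc : ∀ s t, IsProbMassUpTo (blockPairs V s t).card (c s t)) : IsProbMass (blockMass V c) := by
  refine ⟨fun H => prod_nonneg fun st _ => sizeMass_nonneg (hc st.1 st.2).nonneg _, ?_⟩
  unfold blockMass
  rw [sum_graph_prod_block V fun st A => sizeMass (blockPairs V st.1 st.2) (c st.1 st.2) A]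
  exact prod_eq_one fun st _ => by rw [sum_powerset_sizeMass]; exact (hc st.1 st.2).2.2

theorem sum_abs_blockMass_sub_le {V : Fin N → Fin n} {c c' : Fin n → Fin n → ℕ → ℝ}
    (hc : ∀ s t, IsProbMassUpTo (blockPairs V s t).card (c s t))
    (hc' : ∀ s t, IsProbMassUpTo (blockPairs V s t).card (c' s t)) :
    ∑ H, |blockMass V c H - blockMass V c' H| ≤ ∑ st ∈ blockIndices n,
      ∑ m ∈ range ((blockPairs V st.1 st.2).card + 1), |c st.1 st.2 m - c' st.1 st.2 m| := by
  unfold blockMass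
  rw [sum_graph_eq_sum_powerset fun A => |∏ st ∈ blockIndices n,
      sizeMass (blockPairs V st.1 st.2) (c st.1 st.2) (A ∩ blockPairs V st.1 st.2) -
      ∏ st ∈ blockIndices n,
      sizeMass (blockPairs V st.1 st.2) (c' st.1 st.2) (A ∩ blockPairs V st.1 st.2)|,
    ← biUnion_blockPairs V]
  refine (sum_powerset_biUnion_abs_sub_le (blockIndices n) (fun st => blockPairs V st.1 st.2)
    (pairwiseDisjoint_blockPairs V)
    (fun st A => sizeMass (blockPairs V st.1 st.2) (c st.1 st.2) A)
    (fun st A => sizeMass (blockPairs V st.1 st.2) (c' st.1 st.2) A)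
    (fun st _ => sizeMass_nonneg (hc st.1 st.2).nonneg)
    (fun st _ => sizeMass_nonneg (hc' st.1 st.2).nonneg)
    (fun st _ => ?_) (fun st _ => ?_)).trans_eq ?_
  · rw [sum_powerset_sizeMass]; exact (hc st.1 st.2).2.2
  · rw [sum_powerset_sizeMass]; exact (hc' st.1 st.2).2.2
  · exact sum_congr rfl fun st _ => sum_powerset_abs_sizeMass_sub _ _ _

theorem blockMass_binomMass {V : Fin N → Fin n} (w : Sym2 (Fin N) → ℝ) (r : Fin n → Fin n → ℝ)
    (hw : ∀ s t, ∀ e ∈ blockPairs V s t, w e = r s t) (H : SimpleGraph (Fin N)) :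
    blockMass V (fun s t => binomMass (blockPairs V s t).card (r s t)) H
      = indepEdgeMass N w H := by
  rw [indepEdgeMass_eq, prod_edgePairs_eq V, blockMass]
  refine prod_congr rfl fun st _ => ?_
  rw [sizeMass_binomMass inter_subset_right]
  refine prod_congr rfl fun e he => ?_
  simp [he, hw st.1 st.2 e he]

theorem sum_uniform_eq_one {X : Type*} [Fintype X] [Nonempty X] {c : ℝ}
    (hc : c = 1 / Fintype.card X) :
    ∑ _V : Fin N → X, c ^ N = 1 := by
  have : (Fintype.card X : ℝ) ≠ 0 := by exact_mod_cast Fintype.card_ne_zero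
  rw [sum_const, card_univ, Fintype.card_fun, Fintype.card_fin, nsmul_eq_mul, hc]
  push_cast
  rw [← mul_pow, mul_one_div_cancel this, one_pow]

theorem isGraphKernel_reductionMass (hn : 1 ≤ n) (hℓ : 1 ≤ ℓ) (hq0 : 0 ≤ q)
    (hqℓ : 16 * q * (ℓ : ℝ) ^ 2 ≤ 1) (hγ0 : 0 < γ) (hγ : γ ≤ 1 / 2) :
    IsGraphKernel (n := n) (N := N) (reductionMass ℓ (2 * q) q γ) := by
  intro G
  have hB : ∀ V : Fin N → Fin n, IsProbMass (blockMass V (edgeCountMass ℓ (2 * q) q γ G V)) :=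
    fun V => isProbMass_blockMass fun s t =>
      isProbMassUpTo_edgeCountMass hℓ hq0 hqℓ hγ0 hγ G V s t
  have hR : ∀ H, reductionMass ℓ (2 * q) q γ G H = ∑ V : Fin N → Fin n, (1 / (n : ℝ)) ^ N *
      blockMass V (edgeCountMass ℓ (2 * q) q γ G V) H := reductionMass_eq ℓ (2 * q) q γ G
  constructor
  · intro H
    rw [hR]
    exact sum_nonneg fun V _ => mul_nonneg (by positivity) ((hB V).1 H)
  · simp only [hR]
    rw [sum_comm]
    simp only [← mul_sum, (hB _).2, mul_one]
    have : Nonempty (Fin n) := ⟨⟨0, hn⟩⟩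
    exact sum_uniform_eq_one (by simp)

end Kernel

/-! ### Binomial expectations and negative association of occupation numbers -/

/-- The expectation of `f X` for `X ∼ Binom(M, b)`. -/
def binExp (b : ℝ) : ℕ → (ℕ → ℝ) → ℝ
  | 0, f => f 0
  | M + 1, f => (1 - b) * binExp b M f + b * binExp b M fun x => f (x + 1)

section BinExp

variable {b : ℝ}

theorem binExp_mono (h0 : 0 ≤ b) (h1 : b ≤ 1) (M : ℕ) {f g : ℕ → ℝ} (h : ∀ x, f x ≤ g x) :
    binExp b M f ≤ binExp b M g := by
  induction M generalizing f g with
  | zero => exact h 0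
  | succ M ih =>
    have h1' : 0 ≤ 1 - b := by linarith
    have := ih h
    have := ih (f := fun x => f (x + 1)) (g := fun x => g (x + 1)) fun x => h (x + 1)
    simp only [binExp]
    gcongr

theorem binExp_const (b : ℝ) (M : ℕ) (c : ℝ) : (binExp b M fun _ => c) = c := by
  induction M with
  | zero => rfl
  | succ M ih => simp only [binExp, ih]; ring

theorem binExp_add (b : ℝ) (M : ℕ) (f g : ℕ → ℝ) :
    (binExp b M fun x => f x + g x) = binExp b M f + binExp b M g := by
  induction M generalizing f g with
  | zero => rfl
  | succ M ih => simp only [binExp, ih]; ring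

theorem binExp_const_mul (b : ℝ) (M : ℕ) (c : ℝ) (f : ℕ → ℝ) :
    (binExp b M fun x => c * f x) = c * binExp b M f := by
  induction M generalizing f with
  | zero => rfl
  | succ M ih => simp only [binExp, ih]; ring

theorem binExp_nonneg (h0 : 0 ≤ b) (h1 : b ≤ 1) (M : ℕ) {f : ℕ → ℝ} (h : ∀ x, 0 ≤ f x) :
    0 ≤ binExp b M f := by
  simpa [binExp_const] using binExp_mono h0 h1 M h

theorem binExp_cast (b : ℝ) (M : ℕ) : (binExp b M fun x => (x : ℝ)) = M * b := by
  induction M with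
  | zero => simp [binExp]
  | succ M ih =>
    simp only [binExp, Nat.cast_add, Nat.cast_one]
    rw [binExp_add, binExp_const, ih]
    ring

theorem binExp_choose_two (b : ℝ) (M : ℕ) :
    (binExp b M fun x => (x.choose 2 : ℝ)) = M.choose 2 * b ^ 2 := by
  induction M with
  | zero => simp [binExp]
  | succ M ih =>
    simp only [binExp, Nat.choose_succ_succ' _ 1, Nat.choose_one_right, Nat.cast_add]
    rw [binExp_add, binExp_cast, ih]
    ring

end BinExp

/-- The left side consists of the terms of degree at most one in `d` in the expansion of the right
side; the other terms are nonnegative. -/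
theorem prod_add_sum_mul_prod_erase_le {β : Type*} [DecidableEq β] (s : Finset β) {a d : β → ℝ}
    (ha : ∀ b, 0 ≤ a b) (hd : ∀ b, 0 ≤ d b) :
    ∏ b ∈ s, a b + ∑ b ∈ s, d b * ∏ c ∈ s.erase b, a c ≤ ∏ b ∈ s, (a b + d b) := by
  induction s using Finset.induction_on with
  | empty => simp
  | insert c s hc ih =>
    have hsum : ∑ b ∈ s, d b * ∏ x ∈ (insert c s).erase b, a x
        = a c * ∑ b ∈ s, d b * ∏ x ∈ s.erase b, a x := by
      rw [mul_sum]
      refine sum_congr rfl fun b hb => ?_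
      have hbc : c ≠ b := fun h => hc (h ▸ hb)
      rw [erase_insert_of_ne hbc, prod_insert (fun h => hc (mem_of_mem_erase h))]
      ring
    rw [prod_insert hc, prod_insert hc, sum_insert hc, erase_insert hc, hsum]
    have hle : ∏ b ∈ s, a b ≤ ∏ b ∈ s, (a b + d b) :=
      prod_le_prod (fun b _ => ha b) fun b _ => by linarith [hd b]
    have h1 := mul_le_mul_of_nonneg_left ih (ha c)
    have h2 := mul_le_mul_of_nonneg_left hle (hd c)
    linarith

section Occupation

variable {ι B : Type*} [DecidableEq ι]

/-- Resampling one coordinate: `(b, Z) ↦ (Z i, update Z i b)` is an involution. -/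
theorem sum_sum_update [Fintype ι] [Fintype B] (i : ι) (G : (ι → B) → ℝ) :
    ∑ b : B, ∑ Z : ι → B, G (Function.update Z i b) = Fintype.card B * ∑ Z : ι → B, G Z := by
  rw [← nsmul_eq_mul, ← card_univ, ← sum_const, ← sum_product', ← sum_product']
  refine sum_nbij' (fun x => (x.2 i, Function.update x.2 i x.1))
    (fun x => (x.2 i, Function.update x.2 i x.1)) ?_ ?_ ?_ ?_ ?_ <;> simp

variable [DecidableEq B]

theorem card_filter_insert_update {i : ι} {S : Finset ι} (hi : i ∉ S) (Z : ι → B) (b c : B) :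
    #{j ∈ insert i S | Function.update Z i b j = c}
      = #{j ∈ S | Z j = c} + if c = b then 1 else 0 := by
  have hS : S.filter (fun j => Function.update Z i b j = c) = S.filter fun j => Z j = c :=
    filter_congr fun j hj => by
      rw [Function.update_of_ne (fun h : j = i => hi (h ▸ hj))]
  rw [filter_insert, hS, Function.update_self]
  by_cases h : b = c
  · rw [if_pos h, if_pos h.symm, card_insert_of_notMem (by simp [hi])]
  · rw [if_neg h, if_neg (Ne.symm h), add_zero]

/-- A form of negative association, by induction on the number of balls. A new ball raises exactly
one factor, while independent counts could raise several; since the `f b` are nonnegative and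
increasing, independence gives the larger mean. The induction varies `f` because placing the ball in
box `b` shifts `f b` by one. -/
theorem sum_prod_occupation_le [Fintype ι] [Fintype B] [Nonempty B] (S : Finset ι) (f : B → ℕ → ℝ)
    (hf0 : ∀ b x, 0 ≤ f b x) (hf : ∀ b, Monotone (f b)) :
    ∑ Z : ι → B, ∏ b, f b #{i ∈ S | Z i = b}
      ≤ Fintype.card (ι → B) * ∏ b, binExp (1 / Fintype.card B) #S (f b) := by
  induction S using Finset.induction_on generalizing f with
  | empty => simp [binExp]
  | insert i S hi ih =>
    have hcard : (1 : ℝ) ≤ Fintype.card B := by exact_mod_cast Fintype.card_pos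
    set r : ℝ := 1 / Fintype.card B with hr
    have hr0 : 0 ≤ r := by positivity
    have hr1 : r ≤ 1 := by rw [hr, div_le_one (by linarith)]; exact hcard
    have hrc : r * Fintype.card B = 1 := by rw [hr]; field_simp
    set a : B → ℝ := fun b => binExp r #S (f b) with ha
    set a' : B → ℝ := fun b => binExp r #S fun x => f b (x + 1) with ha'
    have ha0 : ∀ b, 0 ≤ a b := fun b => binExp_nonneg hr0 hr1 _ (hf0 b)
    have haa : ∀ b, a b ≤ a' b := fun b => binExp_mono hr0 hr1 _ fun x => hf b x.le_succ
    have hstep : ∀ b, ∑ Z : ι → B,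
        ∏ c, f c #{j ∈ insert i S | Function.update Z i b j = c}
        ≤ Fintype.card (ι → B) * (∏ c, a c + (a' b - a b) * ∏ c ∈ univ.erase b, a c) := by
      intro b
      have h := ih (fun c x => f c (x + if c = b then 1 else 0)) (fun c x => hf0 c _)
        (fun c x y hxy => hf c (by omega))
      refine le_trans (le_of_eq ?_) (h.trans (le_of_eq ?_))
      · exact sum_congr rfl fun Z _ => prod_congr rfl fun c _ => by
          rw [card_filter_insert_update hi]
      · congr 1
        rw [← mul_prod_erase univ _ (mem_univ b), ← mul_prod_erase univ a (mem_univ b)]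
        have hE : ∏ c ∈ univ.erase b, binExp r #S (fun x => f c (x + if c = b then 1 else 0))
            = ∏ c ∈ univ.erase b, a c :=
          prod_congr rfl fun c hc => by simp [ne_of_mem_erase hc, ha]
        rw [hE]
        simp only [if_true]
        ring
    have hsum : Fintype.card B * ∑ Z : ι → B, ∏ c, f c #{j ∈ insert i S | Z j = c}
        ≤ Fintype.card (ι → B) * (Fintype.card B * ∏ c, a c
          + ∑ b, (a' b - a b) * ∏ c ∈ univ.erase b, a c) := by
      rw [← sum_sum_update i]
      refine (sum_le_sum fun b _ => hstep b).trans_eq ?_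
      rw [← mul_sum, sum_add_distrib, sum_const, card_univ, nsmul_eq_mul]
    have hprod := prod_add_sum_mul_prod_erase_le univ (a := a) (d := fun b => r * (a' b - a b)) ha0
      fun b => mul_nonneg hr0 (sub_nonneg.2 (haa b))
    have heq : ∀ b, binExp r #(insert i S) (f b) = a b + r * (a' b - a b) := fun b => by
      rw [card_insert_of_notMem hi]
      simp only [binExp, ha, ha']
      ring
    simp only [heq]
    calc _ = r * (Fintype.card B * ∑ Z : ι → B, ∏ c, f c #{j ∈ insert i S | Z j = c}) := by
          rw [← mul_assoc, hrc, one_mul]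
      _ ≤ r * _ := mul_le_mul_of_nonneg_left hsum hr0
      _ = Fintype.card (ι → B) * (∏ c, a c
          + ∑ b, r * (a' b - a b) * ∏ c ∈ univ.erase b, a c) := by
          simp only [mul_assoc r, ← mul_sum]
          linear_combination (Fintype.card (ι → B) * ∏ c, a c) * hrc
      _ ≤ _ := by gcongr

end Occupation

/-! ### The second moment method -/

/-- Cauchy–Schwarz with weight `ρ`, after recognizing `∑ (ν - ρ)² / ρ = ∑ ν² / ρ - 1`. -/
theorem sum_mul_sub_le_sqrt {Ω : Type*} [Fintype Ω] {ρ ν f : Ω → ℝ} {χ : ℝ}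
    (hρ : ∀ ω, 0 < ρ ω) (hρ1 : ∑ ω, ρ ω = 1) (hν1 : ∑ ω, ν ω = 1)
    (hf0 : ∀ ω, 0 ≤ f ω) (hf1 : ∀ ω, f ω ≤ 1) (hχ : ∑ ω, ν ω ^ 2 / ρ ω ≤ 1 + χ) :
    ∑ ω, f ω * (ν ω - ρ ω) ≤ √χ := by
  apply Real.le_sqrt_of_sq_le
  have hcs := sum_sq_le_sum_mul_sum_of_sq_le_mul univ
    (r := fun ω => f ω * (ν ω - ρ ω)) (f := fun ω => (ν ω - ρ ω) ^ 2 / ρ ω)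
    (g := fun ω => f ω ^ 2 * ρ ω)
    (fun ω _ => div_nonneg (sq_nonneg _) (hρ ω).le)
    (fun ω _ => mul_nonneg (sq_nonneg _) (hρ ω).le)
    (fun ω _ => le_of_eq (by have := (hρ ω).ne'; field_simp))
  have h1 : ∑ ω, (ν ω - ρ ω) ^ 2 / ρ ω = ∑ ω, ν ω ^ 2 / ρ ω - 1 := by
    have : ∀ ω, (ν ω - ρ ω) ^ 2 / ρ ω = ν ω ^ 2 / ρ ω - 2 * ν ω + ρ ω := fun ω => by
      have := (hρ ω).ne'
      field_simp
      ring
    simp only [this, sum_add_distrib, sum_sub_distrib, ← mul_sum, hρ1, hν1]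
    ring
  have h2 : ∑ ω, f ω ^ 2 * ρ ω ≤ 1 := by
    rw [← hρ1]
    refine sum_le_sum fun ω _ => mul_le_of_le_one_left (hρ ω).le ?_
    exact pow_le_one₀ (hf0 ω) (hf1 ω)
  have h3 : 0 ≤ ∑ ω, (ν ω - ρ ω) ^ 2 / ρ ω :=
    sum_nonneg fun ω _ => div_nonneg (sq_nonneg _) (hρ ω).le
  calc _ ≤ _ := hcs
    _ ≤ (∑ ω, (ν ω - ρ ω) ^ 2 / ρ ω) * 1 := mul_le_mul_of_nonneg_left h2 h3
    _ ≤ χ := by linarith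

theorem indepEdgeMass_pos {N : ℕ} {w : Sym2 (Fin N) → ℝ} (h0 : ∀ e, 0 < w e)
    (h1 : ∀ e, w e < 1) (H : SimpleGraph (Fin N)) : 0 < indepEdgeMass N w H := by
  rw [indepEdgeMass_eq]
  refine prod_pos fun e _ => ?_
  split_ifs
  · exact h0 e
  · linarith [h1 e]

/-- The sum factors over pairs. A pair lowered in at most one of the two laws contributes exactly
`1`; a pair lowered in both contributes `1 + q / (2 (1 - 2q)) ≤ 1 + q`. -/
theorem sum_indepEdgeMass_mul_div_le {N : ℕ} {q : ℝ} (hq0 : 0 < q) (hq : q ≤ 1 / 16)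
    (r : Sym2 (Fin N) → ℝ) (hr0 : ∀ e, 0 < r e) (hr1 : ∀ e, r e < 1)
    (D D' : Finset (Sym2 (Fin N))) (hD : D ⊆ edgePairs N) (hr : ∀ e ∈ D, r e = 2 * q) :
    ∑ H, indepEdgeMass N (fun e => if e ∈ D then q else r e) H
        * indepEdgeMass N (fun e => if e ∈ D' then q else r e) H / indepEdgeMass N r H
      ≤ (1 + q) ^ #(D ∩ D') := by
  simp only [indepEdgeMass_eq, ← prod_mul_distrib, ← prod_div_distrib]
  have hite : ∀ (H : SimpleGraph (Fin N)) (e : Sym2 (Fin N)),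
      (if e ∈ edgesOf H then (if e ∈ D then q else r e) else 1 - (if e ∈ D then q else r e)) *
        (if e ∈ edgesOf H then (if e ∈ D' then q else r e) else 1 - (if e ∈ D' then q else r e)) /
        (if e ∈ edgesOf H then r e else 1 - r e)
      = if e ∈ edgesOf H then (if e ∈ D then q else r e) * (if e ∈ D' then q else r e) / r e
        else (1 - (if e ∈ D then q else r e)) * (1 - (if e ∈ D' then q else r e)) / (1 - r e) :=
    fun H e => by split_ifs <;> rfl
  simp only [hite]
  rw [sum_prod_ite_mem]
  have hbound : ∀ e ∈ edgePairs N,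
      (if e ∈ D then q else r e) * (if e ∈ D' then q else r e) / r e
        + (1 - (if e ∈ D then q else r e)) * (1 - (if e ∈ D' then q else r e)) / (1 - r e)
      ≤ if e ∈ D ∩ D' then 1 + q else 1 := by
    intro e _
    have h1 := (hr0 e).ne'
    have h2 : 1 - r e ≠ 0 := by linarith [hr1 e]
    by_cases hD1 : e ∈ D
    · by_cases hD2 : e ∈ D'
      · simp only [hD1, hD2, mem_inter, and_self, if_true, hr e hD1]
        have h3 : 0 < 1 - 2 * q := by linarith
        have h4 : 1 - 2 * q ≠ 0 := h3.ne'
        have : q * q / (2 * q) + (1 - q) * (1 - q) / (1 - 2 * q) = 1 + q / (2 * (1 - 2 * q)) := by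
          rw [div_add_div _ _ (by positivity) h4, one_add_div (by positivity),
            div_eq_div_iff (by positivity) (by positivity)]
          ring
        rw [this]
        have : q / (2 * (1 - 2 * q)) ≤ q := by
          rw [div_le_iff₀ (by linarith)]
          nlinarith
        linarith
      · simp only [hD1, hD2, mem_inter, and_false, if_true, if_false]
        apply le_of_eq
        field_simp
        ring
    · simp only [hD1, mem_inter, false_and, if_false]
      apply le_of_eq
      field_simp
      ring
  refine (prod_le_prod (fun e _ => ?_) hbound).trans_eq ?_
  · have h1 := hr0 e
    have h2 : 0 < 1 - r e := by linarith [hr1 e]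
    have h3 : 0 < 1 - q := by linarith
    apply add_nonneg <;> split_ifs <;> positivity
  · rw [prod_ite, prod_const, prod_const_one, mul_one, filter_mem_eq_inter,
      inter_eq_right.2 (inter_subset_left.trans hD)]

/-! ### Pairs of vertices with the same parent -/

open Classical in
/-- The pairs of distinct vertices of `S` that have the same parent under `U`, when this parent has
at most `2ℓ` children in `S`. -/
def siblingPairs {N : ℕ} {X : Type*} (ℓ : ℕ) (S : Finset (Fin N)) (U : Fin N → X) :
    Finset (Sym2 (Fin N)) :=
  (edgePairs N).filter fun e => ∃ t, (∀ v ∈ e, v ∈ S ∧ U v = t) ∧ #{i ∈ S | U i = t} ≤ 2 * ℓ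

theorem mem_siblingPairs {N : ℕ} {X : Type*} [DecidableEq X] {ℓ : ℕ} {S : Finset (Fin N)}
    {U : Fin N → X} {e : Sym2 (Fin N)} :
    e ∈ siblingPairs ℓ S U ↔
      ¬ e.IsDiag ∧ ∃ t, (∀ v ∈ e, v ∈ S ∧ U v = t) ∧ #{i ∈ S | U i = t} ≤ 2 * ℓ := by
  classical
  simp only [siblingPairs, mem_filter, mem_edgePairs]
  refine and_congr_right fun _ => exists_congr fun t => and_congr_right fun _ => ?_
  exact iff_of_eq (by congr!)

open Classical in
/-- The edge probabilities of the planted dense subgraph on `S`. -/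
def denseProb {N : ℕ} (q : ℝ) (S : Finset (Fin N)) (e : Sym2 (Fin N)) : ℝ :=
  if ∀ v ∈ e, v ∈ S then 2 * q else q

open Classical in
/-- The edge probabilities of the planted dense subgraph on `S`, lowered to `q` on sibling pairs. -/
def multipartiteProb {N : ℕ} {X : Type*} (ℓ : ℕ) (q : ℝ) (S : Finset (Fin N)) (U : Fin N → X)
    (e : Sym2 (Fin N)) : ℝ :=
  if e ∈ siblingPairs ℓ S U then q else denseProb q S e

section Siblings

variable {N ℓ : ℕ} {X : Type*}

/-- A pair that is sibling under both maps lies in one fibre of `(U, U')`. That fibre is part of a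
fibre of `U` with at most `2ℓ` elements in `S`, whence the truncation, which keeps the second moment
finite in scale. -/
theorem card_siblingPairs_inter_le [Fintype X] [DecidableEq X] (S : Finset (Fin N))
    (U U' : Fin N → X) :
    #(siblingPairs ℓ S U ∩ siblingPairs ℓ S U') ≤
      ∑ st : X × X, (min #{i ∈ S | (U i, U' i) = st} (2 * ℓ)).choose 2 := by
  classical
  let T : X × X → Finset (Sym2 (Fin N)) := fun st =>
    if #{i ∈ S | (U i, U' i) = st} ≤ 2 * ℓ then
      ({i ∈ S | (U i, U' i) = st} : Finset (Fin N)).offDiag.image (fun p => s(p.1, p.2)) else ∅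
  have hsub : siblingPairs ℓ S U ∩ siblingPairs ℓ S U' ⊆ univ.biUnion T := by
    intro e he
    rw [mem_inter, mem_siblingPairs, mem_siblingPairs] at he
    obtain ⟨⟨hdiag, s, hs, hsmall⟩, -, t, ht, -⟩ := he
    refine mem_biUnion.2 ⟨(s, t), mem_univ _, ?_⟩
    have hle : #{i ∈ S | (U i, U' i) = (s, t)} ≤ 2 * ℓ := by
      refine le_trans (card_le_card fun i hi => ?_) hsmall
      simp only [mem_filter, Prod.mk.injEq] at hi ⊢
      exact ⟨hi.1, hi.2.1⟩
    simp only [T, if_pos hle]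
    induction e using Sym2.ind with
    | _ i j =>
      refine mem_image.2 ⟨(i, j), ?_, rfl⟩
      have hi := hs i (by simp)
      have hj := hs j (by simp)
      have hi' := ht i (by simp)
      have hj' := ht j (by simp)
      simp only [mem_offDiag, mem_filter, Prod.mk.injEq]
      exact ⟨⟨hi.1, hi.2, hi'.2⟩, ⟨hj.1, hj.2, hj'.2⟩, by simpa using hdiag⟩
  refine (card_le_card hsub).trans (card_biUnion_le.trans (sum_le_sum fun st _ => ?_))
  simp only [T]
  split_ifs with h
  · rw [min_eq_left h]
    exact (Sym2.card_image_offDiag _).le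
  · simp

/-- The truncation makes `q` times the exponent at most `1 / 8`, so the exponential can be
linearized; afterwards the truncation is dropped, leaving an explicit binomial moment. -/
theorem one_add_pow_choose_le {q : ℝ} (hq0 : 0 ≤ q) (hqℓ : 16 * q * (ℓ : ℝ) ^ 2 ≤ 1) (x : ℕ) :
    (1 + q) ^ (min x (2 * ℓ)).choose 2 ≤ 1 + 2 * q * x.choose 2 := by
  set j := (min x (2 * ℓ)).choose 2 with hj
  have h1 : (j : ℝ) ≤ x.choose 2 := by
    exact_mod_cast Nat.choose_le_choose 2 (min_le_left _ _)
  have h2 : (j : ℝ) ≤ 2 * (ℓ : ℝ) ^ 2 := by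
    have h : (j : ℝ) ≤ ((2 * ℓ).choose 2 : ℕ) := by
      exact_mod_cast Nat.choose_le_choose 2 (min_le_right _ _)
    have h' := Nat.choose_le_pow_div (α := ℝ) 2 (2 * ℓ)
    simp only [Nat.factorial] at h'
    push_cast at h'
    linarith
  have hz : q * j ≤ 1 / 8 := by nlinarith
  have hz0 : 0 ≤ q * j := by positivity
  have hexp : (1 + q) ^ j ≤ Real.exp (q * j) := by
    rw [mul_comm q, Real.exp_nat_mul]
    exact pow_le_pow_left₀ (by linarith) (by linarith [Real.add_one_le_exp q]) _
  have hexp2 : Real.exp (q * j) ≤ 1 + 2 * (q * j) := by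
    have h := Real.one_sub_le_exp_neg (q * j)
    rw [Real.exp_neg] at h
    have hpos := Real.exp_pos (q * j)
    have h3 : (1 - q * j) * Real.exp (q * j) ≤ 1 := by
      calc _ ≤ (Real.exp (q * j))⁻¹ * Real.exp (q * j) := by gcongr
        _ = 1 := inv_mul_cancel₀ hpos.ne'
    nlinarith
  calc _ ≤ 1 + 2 * (q * j) := hexp.trans hexp2
    _ ≤ _ := by nlinarith

theorem sum_sum_one_add_pow_le [Fintype X] [Nonempty X] {q : ℝ} (hq0 : 0 ≤ q)
    (hqℓ : 16 * q * (ℓ : ℝ) ^ 2 ≤ 1) (S : Finset (Fin N))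
    (hS : #S ≤ 2 * (Fintype.card X * ℓ)) :
    ∑ U : Fin N → X, ∑ U' : Fin N → X, (1 + q) ^ #(siblingPairs ℓ S U ∩ siblingPairs ℓ S U')
      ≤ (Fintype.card (Fin N → X) : ℝ) ^ 2 * Real.exp (4 * q * (ℓ : ℝ) ^ 2) := by
  classical
  set k := Fintype.card X with hk
  have hk0 : (0 : ℝ) < k := by exact_mod_cast Fintype.card_pos
  have h1 : ∑ U : Fin N → X, ∑ U' : Fin N → X,
      (1 + q) ^ #(siblingPairs ℓ S U ∩ siblingPairs ℓ S U')
      ≤ ∑ Z : Fin N → X × X, ∏ st : X × X,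
        (1 + q) ^ (min #{i ∈ S | Z i = st} (2 * ℓ)).choose 2 := by
    -- Two independent maps to `X` are one uniform map to the `k²` boxes of `X × X`.
    rw [← (Equiv.arrowProdEquivProdArrow (Fin N) (fun _ => X) (fun _ => X)).symm.sum_comp,
      ← sum_product']
    refine sum_le_sum fun p _ => ?_
    rw [prod_pow_eq_pow_sum]
    exact pow_le_pow_right₀ (by linarith) (card_siblingPairs_inter_le S p.1 p.2)
  have h2 := sum_prod_occupation_le (ι := Fin N) (B := X × X) S
    (fun _ x => (1 + q) ^ (min x (2 * ℓ)).choose 2) (fun _ x => by positivity)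
    (fun _ x y hxy => pow_le_pow_right₀ (by linarith)
      (Nat.choose_le_choose 2 (min_le_min_right _ hxy)))
  have hB : Fintype.card (X × X) = k ^ 2 := by rw [Fintype.card_prod, sq]
  have hb0 : (0 : ℝ) ≤ 1 / (k ^ 2 : ℕ) := by positivity
  have hb1 : (1 : ℝ) / (k ^ 2 : ℕ) ≤ 1 := by
    rw [div_le_one (by positivity)]
    exact_mod_cast Nat.one_le_pow _ _ Fintype.card_pos
  have h3 : binExp (1 / (k ^ 2 : ℕ)) #S (fun x => (1 + q) ^ (min x (2 * ℓ)).choose 2)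
      ≤ Real.exp (4 * q * (ℓ : ℝ) ^ 2 / k ^ 2) := by
    refine (binExp_mono hb0 hb1 _ (one_add_pow_choose_le hq0 hqℓ)).trans ?_
    rw [binExp_add, binExp_const, binExp_const_mul, binExp_choose_two]
    have hM : ((#S).choose 2 : ℝ) ≤ 2 * (k * ℓ) ^ 2 := by
      have h := Nat.choose_le_pow_div (α := ℝ) 2 #S
      have h' : (#S : ℝ) ≤ 2 * (k * ℓ) := by exact_mod_cast hS
      have h'' : (#S : ℝ) ^ 2 ≤ (2 * (k * ℓ)) ^ 2 := pow_le_pow_left₀ (by positivity) h' 2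
      simp only [Nat.factorial] at h
      push_cast at h
      linarith
    calc 1 + 2 * q * ((#S).choose 2 * (1 / ((k ^ 2 : ℕ) : ℝ)) ^ 2)
        ≤ 1 + 2 * q * (2 * (k * ℓ) ^ 2 * (1 / ((k ^ 2 : ℕ) : ℝ)) ^ 2) := by gcongr
      _ = 4 * q * (ℓ : ℝ) ^ 2 / k ^ 2 + 1 := by
          push_cast
          field_simp
          ring
      _ ≤ _ := Real.add_one_le_exp _
  refine h1.trans (h2.trans ?_)
  rw [prod_const, card_univ, hB]
  have hcard : (Fintype.card (Fin N → X × X) : ℝ) = (Fintype.card (Fin N → X) : ℝ) ^ 2 := by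
    rw [Fintype.card_fun, Fintype.card_fun, Fintype.card_prod]
    push_cast
    ring
  rw [hcard]
  gcongr
  refine (pow_le_pow_left₀ (binExp_nonneg hb0 hb1 _ fun x => by positivity) h3 _).trans_eq ?_
  rw [← Real.exp_nat_mul]
  congr 1
  push_cast
  field_simp

theorem siblingPairs_subset {S : Finset (Fin N)} {U : Fin N → X} :
    siblingPairs ℓ S U ⊆ edgePairs N := by
  classical
  exact fun e he => mem_edgePairs.2 (mem_siblingPairs.1 he).1

theorem denseProb_pos {q : ℝ} (hq0 : 0 < q) (S : Finset (Fin N)) (e : Sym2 (Fin N)) :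
    0 < denseProb q S e := by
  unfold denseProb; split_ifs <;> linarith

theorem denseProb_lt_one {q : ℝ} (hq0 : 0 < q) (hq : q ≤ 1 / 16) (S : Finset (Fin N))
    (e : Sym2 (Fin N)) : denseProb q S e < 1 := by
  unfold denseProb; split_ifs <;> linarith

theorem denseProb_of_mem_siblingPairs {q : ℝ} {S : Finset (Fin N)} {U : Fin N → X}
    {e : Sym2 (Fin N)} (he : e ∈ siblingPairs ℓ S U) : denseProb q S e = 2 * q := by
  classical
  obtain ⟨-, t, ht, -⟩ := mem_siblingPairs.1 he
  exact if_pos fun v hv => (ht v hv).1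

theorem sum_mul_multipartite_sub_dense_le [Fintype X] [Nonempty X] (hℓ : 1 ≤ ℓ) {q : ℝ}
    (hq0 : 0 < q) (hqℓ : 16 * q * (ℓ : ℝ) ^ 2 ≤ 1) (S : Finset (Fin N))
    (hS : #S ≤ 2 * (Fintype.card X * ℓ)) {f : SimpleGraph (Fin N) → ℝ}
    (hf0 : ∀ H, 0 ≤ f H) (hf1 : ∀ H, f H ≤ 1) :
    ∑ H, f H * ((∑ U : Fin N → X, (1 / (Fintype.card (Fin N → X) : ℝ)) *
        indepEdgeMass N (multipartiteProb ℓ q S U) H) - indepEdgeMass N (denseProb q S) H)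
      ≤ √(Real.exp (4 * q * (ℓ : ℝ) ^ 2) - 1) := by
  have hq := le_one_div_sixteen hℓ hq0.le hqℓ
  have hr0 := denseProb_pos hq0 S
  have hr1 := denseProb_lt_one hq0 hq S
  set c : ℝ := 1 / (Fintype.card (Fin N → X) : ℝ) with hc
  have hcard : (0 : ℝ) < Fintype.card (Fin N → X) := by exact_mod_cast Fintype.card_pos
  refine sum_mul_sub_le_sqrt (indepEdgeMass_pos hr0 hr1) (sum_indepEdgeMass _) ?_ hf0 hf1 ?_
  · rw [sum_comm]
    simp only [← mul_sum, sum_indepEdgeMass, sum_const, card_univ, nsmul_eq_mul, mul_one]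
    rw [hc]
    field_simp
  · have hexpand : ∀ H, (∑ U : Fin N → X, c * indepEdgeMass N (multipartiteProb ℓ q S U) H) ^ 2
        / indepEdgeMass N (denseProb q S) H
        = c ^ 2 * ∑ U : Fin N → X, ∑ U' : Fin N → X,
          indepEdgeMass N (multipartiteProb ℓ q S U) H *
            indepEdgeMass N (multipartiteProb ℓ q S U') H
            / indepEdgeMass N (denseProb q S) H := fun H => by
      rw [← mul_sum, mul_pow, mul_div_assoc, sq (∑ U : Fin N → X, _), sum_mul_sum]
      simp only [sum_div]
    simp only [hexpand]
    rw [← mul_sum, sum_comm]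
    have hle : ∑ U : Fin N → X, ∑ H, ∑ U' : Fin N → X,
          indepEdgeMass N (multipartiteProb ℓ q S U) H *
            indepEdgeMass N (multipartiteProb ℓ q S U') H
            / indepEdgeMass N (denseProb q S) H
        ≤ (Fintype.card (Fin N → X) : ℝ) ^ 2 * Real.exp (4 * q * (ℓ : ℝ) ^ 2) := by
      refine le_trans (sum_le_sum fun U _ => ?_) (sum_sum_one_add_pow_le hq0.le hqℓ S hS)
      rw [sum_comm]
      refine sum_le_sum fun U' _ => ?_
      classical
      have := sum_indepEdgeMass_mul_div_le hq0 hq (denseProb q S) hr0 hr1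
        (siblingPairs ℓ S U) (siblingPairs ℓ S U') siblingPairs_subset
        fun e he => denseProb_of_mem_siblingPairs he
      exact this
    calc _ ≤ c ^ 2 * ((Fintype.card (Fin N → X) : ℝ) ^ 2 * Real.exp (4 * q * (ℓ : ℝ) ^ 2)) := by
          gcongr
      _ = _ := by
          rw [hc]
          field_simp
          ring

end Siblings

/-! ### Descendants of a set of parents -/

/-- The vertices whose parent is in `C`. -/
def childrenOf {n N : ℕ} (C : Finset (Fin n)) (V : Fin N → Fin n) : Finset (Fin N) :=
  univ.filter fun i => V i ∈ C

theorem mem_childrenOf {n N : ℕ} {C : Finset (Fin n)} {V : Fin N → Fin n} {i : Fin N} :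
    i ∈ childrenOf C V ↔ V i ∈ C := by
  simp [childrenOf]

theorem childrenOf_singleton {n N : ℕ} (V : Fin N → Fin n) (t : Fin n) :
    #(childrenOf {t} V) = numChildren V t := by
  simp [childrenOf, numChildren]

theorem exp_mul_div_four_pow_le (m : ℕ) :
    Real.exp m / 4 ^ m ≤ Real.exp (-(m : ℝ) / 12) := by
  have h1 : Real.exp 1 / 4 ≤ Real.exp (-(1 / 12)) := by
    have h := Real.one_sub_le_exp_neg (1 / 12)
    have he := Real.exp_one_lt_d9
    linarith
  calc Real.exp m / 4 ^ m = (Real.exp 1 / 4) ^ m := by rw [div_pow, Real.exp_one_pow]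
    _ ≤ Real.exp (-(1 / 12)) ^ m := pow_le_pow_left₀ (by positivity) h1 m
    _ = _ := by rw [← Real.exp_nat_mul]; ring_nf

theorem sum_two_pow_card_childrenOf {n N : ℕ} (C : Finset (Fin n)) :
    ∑ V : Fin N → Fin n, (2 : ℝ) ^ #(childrenOf C V) = (n + #C) ^ N := by
  have h : ∀ V : Fin N → Fin n, (2 : ℝ) ^ #(childrenOf C V) = ∏ i, if V i ∈ C then 2 else 1 :=
    fun V => by rw [prod_ite, prod_const, prod_const_one, mul_one, childrenOf]
  simp only [h]
  rw [← Fintype.sum_pow (fun x : Fin n => if x ∈ C then (2 : ℝ) else 1) N]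
  congr 1
  have h2 : ∀ x : Fin n, (if x ∈ C then (2 : ℝ) else 1) = 1 + if x ∈ C then 1 else 0 :=
    fun x => by split_ifs <;> norm_num
  simp only [h2, sum_add_distrib]
  simp

/-- Markov's inequality for `2 ^ #(childrenOf C V)`, whose mean is `(1 + #C / n) ^ (ℓ n) ≤ e ^ (#C
ℓ)`. It is used for `C` itself and for single parents. -/
theorem sum_uniform_card_childrenOf_gt_le {n ℓ : ℕ} (hn : 1 ≤ n) (C : Finset (Fin n)) :
    ∑ V : Fin (ℓ * n) → Fin n, (1 / (n : ℝ)) ^ (ℓ * n) *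
        (if 2 * (#C * ℓ) < #(childrenOf C V) then 1 else 0)
      ≤ Real.exp (-((#C * ℓ : ℕ) : ℝ) / 12) := by
  have hn0 : (0 : ℝ) < n := by exact_mod_cast hn
  refine le_trans ?_ (exp_mul_div_four_pow_le (#C * ℓ))
  have h1 : ∀ V : Fin (ℓ * n) → Fin n,
      (if 2 * (#C * ℓ) < #(childrenOf C V) then (1 : ℝ) else 0)
        ≤ 2 ^ #(childrenOf C V) / 4 ^ (#C * ℓ) := fun V => by
    split_ifs with h
    · rw [one_le_div (by positivity), show (4 : ℝ) = 2 ^ 2 by norm_num, ← pow_mul]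
      exact pow_le_pow_right₀ (by norm_num) h.le
    · positivity
  calc _ ≤ ∑ V : Fin (ℓ * n) → Fin n, (1 / (n : ℝ)) ^ (ℓ * n) *
          (2 ^ #(childrenOf C V) / 4 ^ (#C * ℓ)) :=
        sum_le_sum fun V _ => mul_le_mul_of_nonneg_left (h1 V) (by positivity)
    _ = (#C / n + 1 : ℝ) ^ (ℓ * n) / 4 ^ (#C * ℓ) := by
        rw [← mul_sum, ← sum_div, sum_two_pow_card_childrenOf, ← mul_div_assoc, ← mul_pow]
        congr 2
        field_simp
        ring
    _ ≤ Real.exp (#C / n : ℝ) ^ (ℓ * n) / 4 ^ (#C * ℓ) := by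
        gcongr
        exact Real.add_one_le_exp _
    _ = _ := by
        rw [← Real.exp_nat_mul]
        congr 2
        push_cast
        field_simp

theorem card_filter_childrenOf_eq {n N : ℕ} (C : Finset (Fin n)) (S : Finset (Fin N)) :
    #{V : Fin N → Fin n | childrenOf C V = S} = #C ^ #S * (n - #C) ^ (N - #S) := by
  have h : ({V : Fin N → Fin n | childrenOf C V = S} : Finset _)
      = Fintype.piFinset fun i => if i ∈ S then C else Cᶜ := by
    ext V
    simp only [mem_filter, mem_univ, true_and, Fintype.mem_piFinset, Finset.ext_iff, mem_childrenOf]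
    refine forall_congr' fun i => ?_
    by_cases hi : i ∈ S <;> simp [hi]
  rw [h, Fintype.card_piFinset]
  have h2 : ∀ i, #(if i ∈ S then C else Cᶜ) = if i ∈ S then #C else n - #C := fun i => by
    split_ifs
    · rfl
    · rw [card_compl, Fintype.card_fin]
  simp only [h2]
  rw [prod_ite, prod_const, prod_const, filter_mem_eq_inter, univ_inter, filter_notMem_eq_sdiff,
    card_sdiff_of_subset (subset_univ S), card_univ, Fintype.card_fin]

/-- Each vertex has its parent in `C` independently with probability `k / n = K / N`, whichever `C`
is chosen; the identity is a count of the fibres of `childrenOf C`. -/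
theorem plantedDenseMass_eq_sum {n ℓ k : ℕ} (hℓ : 1 ≤ ℓ) (hn : 1 ≤ n) (q : ℝ) (C : Finset (Fin n))
    (hC : #C = k) (H : SimpleGraph (Fin (ℓ * n))) :
    plantedDenseMass (ℓ * n) (k * ℓ) (2 * q) q H
      = ∑ V : Fin (ℓ * n) → Fin n, (1 / (n : ℝ)) ^ (ℓ * n) *
        indepEdgeMass (ℓ * n) (denseProb q (childrenOf C V)) H := by
  have hn0 : (n : ℝ) ≠ 0 := by positivity
  have hℓ0 : (ℓ : ℝ) ≠ 0 := by positivity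
  rw [← sum_fiberwise univ (childrenOf C)]
  refine sum_congr rfl fun S _ => ?_
  rw [sum_congr rfl (g := fun _ => (1 / (n : ℝ)) ^ (ℓ * n) *
      indepEdgeMass (ℓ * n) (denseProb q S) H) fun V hV => by rw [(mem_filter.1 hV).2],
    sum_const, card_filter_childrenOf_eq, nsmul_eq_mul, hC, ← mul_assoc]
  have hkn : k ≤ n := by
    rw [← hC]
    simpa using card_le_univ C
  have hS : #S ≤ ℓ * n := by simpa using card_le_univ S
  congr 1
  have hK : ((k * ℓ : ℕ) : ℝ) / ((ℓ * n : ℕ) : ℝ) = k / n := by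
    push_cast
    field_simp
  rw [hK, Nat.cast_mul, Nat.cast_pow, Nat.cast_pow, Nat.cast_sub hkn, one_sub_div hn0, div_pow,
    div_pow, one_div, inv_pow]
  have hpow : (n : ℝ) ^ (ℓ * n) = n ^ #S * n ^ (ℓ * n - #S) := by
    rw [← pow_add, Nat.add_sub_cancel' hS]
  rw [hpow]
  field_simp

/-! ### Resampling the parents inside a set -/

section Resample

variable {n N : ℕ} (C : Finset (Fin n))

/-- Exchange the parents in `C` with the resampled ones. -/
def swapParents (x : (Fin N → Fin n) × (Fin N → C)) : (Fin N → Fin n) × (Fin N → C) :=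
  (fun i => if x.1 i ∈ C then x.2 i else x.1 i,
    fun i => if h : x.1 i ∈ C then ⟨x.1 i, h⟩ else x.2 i)

theorem swapParents_involutive : Function.Involutive (swapParents (N := N) C) := by
  rintro ⟨V, U⟩
  refine Prod.ext (funext fun i => ?_) (funext fun i => ?_)
  · by_cases h : V i ∈ C <;> simp [swapParents, h]
  · by_cases h : V i ∈ C <;> simp [swapParents, h]

theorem childrenOf_swapParents (x : (Fin N → Fin n) × (Fin N → C)) :
    childrenOf C (swapParents C x).1 = childrenOf C x.1 := by
  ext i
  rw [mem_childrenOf, mem_childrenOf]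
  by_cases h : x.1 i ∈ C <;> simp [swapParents, h]

/-- Given `S = childrenOf C V`, the parents on `S` are uniform on `C`. The swap is a bijection of
the pairs `(V, U)` that preserves `S` and installs `U` as the parents on `S`; coordinates of `U` off
`S` are idle. -/
theorem card_mul_sum_eq_sum_resample (g : Finset (Fin N) → (Fin N → Fin n) → ℝ)
    (g' : Finset (Fin N) → (Fin N → C) → ℝ)
    (hg : ∀ S V U, (∀ i ∈ S, V i = U i) → g S V = g' S U) :
    (Fintype.card (Fin N → C) : ℝ) * ∑ V : Fin N → Fin n, g (childrenOf C V) V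
      = ∑ V : Fin N → Fin n, ∑ U : Fin N → C, g' (childrenOf C V) U := by
  have h1 : (Fintype.card (Fin N → C) : ℝ) * ∑ V : Fin N → Fin n, g (childrenOf C V) V
      = ∑ x : (Fin N → Fin n) × (Fin N → C), g (childrenOf C x.1) x.1 := by
    rw [Fintype.sum_prod_type, mul_sum]
    simp
  rw [h1, ← Equiv.sum_comp (swapParents_involutive (N := N) C).toPerm, Fintype.sum_prod_type]
  refine sum_congr rfl fun V _ => sum_congr rfl fun U _ => ?_
  rw [Function.Involutive.coe_toPerm, childrenOf_swapParents]
  refine hg _ _ _ fun i hi => ?_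
  simp [swapParents, mem_childrenOf.1 hi]

theorem multipartiteProb_congr {X Y : Type*} {ℓ : ℕ} {q : ℝ} {S : Finset (Fin N)} {V : Fin N → X}
    {U : Fin N → Y} (ι : Y → X) (hι : Function.Injective ι) (h : ∀ i ∈ S, V i = ι (U i)) :
    multipartiteProb ℓ q S V = multipartiteProb ℓ q S U := by
  classical
  have hcount : ∀ u, S.filter (fun i => V i = ι u) = S.filter fun i => U i = u := fun u =>
    filter_congr fun i hi => by rw [h i hi, hι.eq_iff]
  have hs : siblingPairs ℓ S V = siblingPairs ℓ S U := by
    ext e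
    rw [mem_siblingPairs, mem_siblingPairs]
    refine and_congr_right fun _ => ⟨?_, ?_⟩
    · rintro ⟨t, ht, hc⟩
      induction e using Sym2.ind with
      | _ i j =>
        have hi := ht i (by simp)
        have htU : t = ι (U i) := by rw [← hi.2, h i hi.1]
        subst htU
        rw [hcount] at hc
        refine ⟨U i, fun v hv => ⟨(ht v hv).1, hι ?_⟩, hc⟩
        rw [← h v (ht v hv).1]
        exact (ht v hv).2
    · rintro ⟨u, hu, hc⟩
      refine ⟨ι u, fun v hv => ⟨(hu v hv).1, ?_⟩, by rwa [hcount]⟩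
      rw [h v (hu v hv).1, (hu v hv).2]
  funext e
  simp only [multipartiteProb, hs]

end Resample

/-! ### Comparison of the laws under the alternative -/

theorem sum_mul_sub_le_one {Ω : Type*} [Fintype Ω] {μ ν f : Ω → ℝ} (hμ : IsProbMass μ)
    (hν : IsProbMass ν) (hf0 : ∀ ω, 0 ≤ f ω) (hf1 : ∀ ω, f ω ≤ 1) :
    ∑ ω, f ω * (μ ω - ν ω) ≤ 1 := by
  rw [← hμ.2]
  refine sum_le_sum fun ω _ => ?_
  nlinarith [hμ.1 ω, hν.1 ω, hf0 ω, hf1 ω, mul_nonneg (hf0 ω) (hν.1 ω),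
    mul_nonneg (sub_nonneg.2 (hf1 ω)) (hμ.1 ω)]

theorem sum_mul_sub_le_sum_abs {Ω : Type*} [Fintype Ω] {μ ν f : Ω → ℝ} (hf0 : ∀ ω, 0 ≤ f ω)
    (hf1 : ∀ ω, f ω ≤ 1) : ∑ ω, f ω * (μ ω - ν ω) ≤ ∑ ω, |μ ω - ν ω| :=
  sum_le_sum fun ω _ => (mul_le_mul_of_nonneg_left (le_abs_self _) (hf0 ω)).trans
    (mul_le_of_le_one_left (abs_nonneg _) (hf1 ω))

section Alternative

variable {ℓ n N : ℕ} {q γ : ℝ}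

theorem isProbMass_dense (hq0 : 0 < q) (hq : q ≤ 1 / 16) (S : Finset (Fin N)) :
    IsProbMass (indepEdgeMass N (denseProb q S)) :=
  ⟨indepEdgeMass_nonneg (fun e => (denseProb_pos hq0 S e).le)
    fun e => (denseProb_lt_one hq0 hq S e).le, sum_indepEdgeMass _⟩

theorem isProbMass_multipartite {X : Type*} (hq0 : 0 < q) (hq : q ≤ 1 / 16) (S : Finset (Fin N))
    (U : Fin N → X) : IsProbMass (indepEdgeMass N (multipartiteProb ℓ q S U)) := by
  refine ⟨indepEdgeMass_nonneg (fun e => ?_) fun e => ?_, sum_indepEdgeMass _⟩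
  · unfold multipartiteProb
    split_ifs
    · exact hq0.le
    · exact (denseProb_pos hq0 S e).le
  · unfold multipartiteProb
    split_ifs
    · linarith
    · exact (denseProb_lt_one hq0 hq S e).le

open Classical in
-- When no parent in `C` has too many children, the size condition on siblings is vacuous and the
-- edge probabilities are constant on blocks, which permits a blockwise comparison.
theorem multipartiteProb_of_mem_blockPairs {C : Finset (Fin n)} {V : Fin N → Fin n}
    (hV : ∀ t ∈ C, numChildren V t ≤ 2 * ℓ) (s t : Fin n) (e : Sym2 (Fin N))
    (he : e ∈ blockPairs V s t) :
    multipartiteProb ℓ q (childrenOf C V) V e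
      = if s ≠ t ∧ s ∈ C ∧ t ∈ C then 2 * q else q := by
  rw [mem_blockPairs] at he
  obtain ⟨hdiag, hmap⟩ := he
  have hmem : (∀ v ∈ e, v ∈ childrenOf C V) ↔ s ∈ C ∧ t ∈ C := by
    simp only [mem_childrenOf]
    have : (∀ v ∈ e, V v ∈ C) ↔ ∀ x ∈ e.map V, x ∈ C := by simp [Sym2.mem_map]
    rw [this, hmap]
    simp
  have hsib : e ∈ siblingPairs ℓ (childrenOf C V) V ↔ s = t ∧ s ∈ C := by
    rw [mem_siblingPairs]
    have hall : ∀ u, (∀ v ∈ e, V v = u) ↔ s = u ∧ t = u := fun u => by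
      have : (∀ v ∈ e, V v = u) ↔ ∀ x ∈ e.map V, x = u := by simp [Sym2.mem_map]
      rw [this, hmap]
      simp
    constructor
    · rintro ⟨-, u, hu, -⟩
      have h1 := (hall u).1 fun v hv => (hu v hv).2
      exact ⟨h1.1.trans h1.2.symm, (hmem.1 fun v hv => (hu v hv).1).1⟩
    · rintro ⟨rfl, hs⟩
      refine ⟨hdiag, s, fun v hv => ⟨hmem.2 ⟨hs, hs⟩ v hv, (hall s).2 ⟨rfl, rfl⟩ v hv⟩, ?_⟩
      refine le_trans (card_le_card fun i hi => ?_) (hV s hs)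
      simp only [mem_filter, mem_univ, true_and] at hi ⊢
      exact hi.2
  unfold multipartiteProb denseProb
  simp only [hsib, hmem]
  by_cases hst : s = t <;> by_cases hs : s ∈ C <;> by_cases ht : t ∈ C <;> simp_all

theorem sum_abs_blockMass_sub_multipartite_le (hℓ : 1 ≤ ℓ) (hq0 : 0 < q)
    (hqℓ : 16 * q * (ℓ : ℝ) ^ 2 ≤ 1) (hγ0 : 0 < γ) (hγ : γ ≤ 1 / 2) {C : Finset (Fin n)}
    {V : Fin N → Fin n} (hV : ∀ t ∈ C, numChildren V t ≤ 2 * ℓ) :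
    ∑ H, |blockMass V (plantedCountMass ℓ (2 * q) q γ C V) H
        - indepEdgeMass N (multipartiteProb ℓ q (childrenOf C V) V) H|
      ≤ 2 * (#C : ℝ) ^ 2 * (8 * q * (ℓ : ℝ) ^ 2) ^ (mZero γ + 1) := by
  classical
  have hq := le_one_div_sixteen hℓ hq0.le hqℓ
  set r : Fin n → Fin n → ℝ := fun s t => if s ≠ t ∧ s ∈ C ∧ t ∈ C then 2 * q else q with hr
  have hr0 : ∀ s t, 0 ≤ r s t := fun s t => by simp only [hr]; split_ifs <;> linarith
  have hr1 : ∀ s t, r s t ≤ 1 := fun s t => by simp only [hr]; split_ifs <;> linarith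
  simp only [← blockMass_binomMass _ r (multipartiteProb_of_mem_blockPairs hV)]
  refine (sum_abs_blockMass_sub_le
    (fun s t => isProbMassUpTo_plantedCountMass hℓ hq0.le hqℓ hγ0 hγ C V s t)
    (fun s t => isProbMassUpTo_binomMass (hr0 s t) (hr1 s t) _)).trans ?_
  set x := (8 * q * (ℓ : ℝ) ^ 2) ^ (mZero γ + 1) with hx
  have hx0 : 0 ≤ x := by positivity
  have hterm : ∀ st : Fin n × Fin n, ∑ m ∈ range (#(blockPairs V st.1 st.2) + 1),
      |plantedCountMass ℓ (2 * q) q γ C V st.1 st.2 m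
        - binomMass #(blockPairs V st.1 st.2) (r st.1 st.2) m|
      ≤ if st ∈ C ×ˢ C then 2 * x else 0 := by
    rintro ⟨s, t⟩
    by_cases h : s ≠ t ∧ s ∈ C ∧ t ∈ C
    · have hs := hV s h.2.1
      have ht := hV t h.2.2
      have hL := four_mul_mul_le_one hq0.le hqℓ hs ht
      simp only [plantedCountMass, hr, if_pos h, mem_product, h.2, and_self, if_true,
        max_le hs ht, h, card_blockPairs_of_ne V h.1, ne_eq, not_false_eq_true]
      refine (sum_abs_pPrimeMass_sub_le hq0.le hq hγ0 hγ hL).trans ?_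
      refine mul_le_mul_of_nonneg_left (pow_le_pow_left₀ (by positivity) ?_ _) (by norm_num)
      have h4 : ((numChildren V s * numChildren V t : ℕ) : ℝ) ≤ (2 * ℓ * (2 * ℓ) : ℕ) := by
        exact_mod_cast Nat.mul_le_mul hs ht
      push_cast at h4 ⊢
      nlinarith
    · have : ∀ m, plantedCountMass ℓ (2 * q) q γ C V s t m
          = binomMass #(blockPairs V s t) q m := fun m => by
        rw [plantedCountMass, if_neg (fun h' => h h'.1)]
      simp only [this, hr, if_neg h, sub_self, abs_zero, sum_const_zero]
      split_ifs <;> positivity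
  calc _ ≤ ∑ st ∈ blockIndices n, (if st ∈ C ×ˢ C then 2 * x else 0) :=
        sum_le_sum fun st _ => hterm st
    -- Counting all ordered pairs in `C × C` is wasteful but already gives `k²`.
    _ ≤ ∑ st : Fin n × Fin n, (if st ∈ C ×ˢ C then 2 * x else 0) :=
        sum_le_sum_of_subset_of_nonneg (subset_univ _) fun st _ _ => by
          split_ifs <;> positivity
    _ = _ := by
        rw [← sum_filter, filter_mem_eq_inter, univ_inter, sum_const, card_product, nsmul_eq_mul]
        push_cast
        ring

variable {f : SimpleGraph (Fin N) → ℝ}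

/-- On the bad event the difference is bounded by `1`, and the sum of indicators performs the union
bound over the parents in `C`. -/
theorem sum_mul_blockMass_sub_multipartite_le (hℓ : 1 ≤ ℓ) (hq0 : 0 < q)
    (hqℓ : 16 * q * (ℓ : ℝ) ^ 2 ≤ 1) (hγ0 : 0 < γ) (hγ : γ ≤ 1 / 2) (C : Finset (Fin n))
    (V : Fin N → Fin n) (hf0 : ∀ H, 0 ≤ f H) (hf1 : ∀ H, f H ≤ 1) :
    ∑ H, f H * (blockMass V (plantedCountMass ℓ (2 * q) q γ C V) H
        - indepEdgeMass N (multipartiteProb ℓ q (childrenOf C V) V) H)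
      ≤ 2 * (#C : ℝ) ^ 2 * (8 * q * (ℓ : ℝ) ^ 2) ^ (mZero γ + 1)
        + ∑ t ∈ C, if 2 * ℓ < numChildren V t then 1 else 0 := by
  have hq := le_one_div_sixteen hℓ hq0.le hqℓ
  have hx : 0 ≤ 2 * (#C : ℝ) ^ 2 * (8 * q * (ℓ : ℝ) ^ 2) ^ (mZero γ + 1) := by positivity
  have hnn : ∀ t ∈ C, (0 : ℝ) ≤ if 2 * ℓ < numChildren V t then 1 else 0 := fun t _ => by
    split_ifs <;> norm_num
  by_cases hV : ∀ t ∈ C, numChildren V t ≤ 2 * ℓ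
  · have h1 := sum_abs_blockMass_sub_multipartite_le hℓ hq0 hqℓ hγ0 hγ hV
    have h2 := sum_mul_sub_le_sum_abs (μ := blockMass V (plantedCountMass ℓ (2 * q) q γ C V))
      (ν := indepEdgeMass N (multipartiteProb ℓ q (childrenOf C V) V)) hf0 hf1
    have h3 := sum_nonneg hnn
    linarith
  · push Not at hV
    obtain ⟨t, ht, hlt⟩ := hV
    have h1 := sum_mul_sub_le_one
      (isProbMass_blockMass fun s t =>
        isProbMassUpTo_plantedCountMass hℓ hq0.le hqℓ hγ0 hγ C V s t)
      (isProbMass_multipartite (ℓ := ℓ) hq0 hq (childrenOf C V) V) hf0 hf1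
    have h2 := single_le_sum hnn ht
    rw [if_pos hlt] at h2
    linarith

end Alternative

/-! ### Averaging over the parents -/

section Averaged

variable {ℓ n : ℕ} {q γ : ℝ} {f : SimpleGraph (Fin (ℓ * n)) → ℝ}

theorem sum_uniform_fin_eq_one (hn : 1 ≤ n) (N : ℕ) :
    ∑ _V : Fin N → Fin n, (1 / (n : ℝ)) ^ N = 1 :=
  have : Nonempty (Fin n) := ⟨⟨0, hn⟩⟩
  sum_uniform_eq_one (by simp)

theorem sum_uniform_blockMass_sub_multipartite_le (hℓ : 1 ≤ ℓ) (hn : 1 ≤ n) (hq0 : 0 < q)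
    (hqℓ : 16 * q * (ℓ : ℝ) ^ 2 ≤ 1) (hγ0 : 0 < γ) (hγ : γ ≤ 1 / 2) (C : Finset (Fin n))
    (hf0 : ∀ H, 0 ≤ f H) (hf1 : ∀ H, f H ≤ 1) :
    ∑ V : Fin (ℓ * n) → Fin n, (1 / (n : ℝ)) ^ (ℓ * n) *
        ∑ H, f H * (blockMass V (plantedCountMass ℓ (2 * q) q γ C V) H
          - indepEdgeMass (ℓ * n) (multipartiteProb ℓ q (childrenOf C V) V) H)
      ≤ 2 * (#C : ℝ) ^ 2 * (8 * q * (ℓ : ℝ) ^ 2) ^ (mZero γ + 1)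
        + #C * Real.exp (-(ℓ : ℝ) / 12) := by
  refine (sum_le_sum fun V _ => mul_le_mul_of_nonneg_left
    (sum_mul_blockMass_sub_multipartite_le hℓ hq0 hqℓ hγ0 hγ C V hf0 hf1) (by positivity)).trans ?_
  simp only [mul_add, sum_add_distrib, ← sum_mul, sum_uniform_fin_eq_one hn, one_mul]
  gcongr
  simp only [mul_sum]
  rw [sum_comm, ← nsmul_eq_mul]
  refine sum_le_card_nsmul _ _ _ fun t _ => ?_
  have h := sum_uniform_card_childrenOf_gt_le (ℓ := ℓ) hn {t}
  simpa only [card_singleton, one_mul, childrenOf_singleton] using h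

theorem sum_uniform_multipartite_sub_dense_le (hℓ : 1 ≤ ℓ) (hn : 1 ≤ n) (hq0 : 0 < q)
    (hqℓ : 16 * q * (ℓ : ℝ) ^ 2 ≤ 1) {C : Finset (Fin n)} (hC : C.Nonempty)
    (hf0 : ∀ H, 0 ≤ f H) (hf1 : ∀ H, f H ≤ 1) :
    ∑ V : Fin (ℓ * n) → Fin n, (1 / (n : ℝ)) ^ (ℓ * n) *
        ∑ H, f H * (indepEdgeMass (ℓ * n) (multipartiteProb ℓ q (childrenOf C V) V) H
          - indepEdgeMass (ℓ * n) (denseProb q (childrenOf C V)) H)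
      ≤ Real.exp (-((#C * ℓ : ℕ) : ℝ) / 12) + √(Real.exp (4 * q * (ℓ : ℝ) ^ 2) - 1) := by
  have hq := le_one_div_sixteen hℓ hq0.le hqℓ
  have : Nonempty C := hC.to_subtype
  set w : ℝ := (1 / (n : ℝ)) ^ (ℓ * n) with hw
  have hw0 : 0 ≤ w := by positivity
  set c : ℝ := ((Fintype.card (Fin (ℓ * n) → C) : ℕ) : ℝ) with hc
  have hc0 : 0 < c := by rw [hc]; exact_mod_cast Fintype.card_pos
  -- The type `X` is a parameter so that `Δ` can be evaluated both at the parents in `Fin n` and,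
  -- after resampling, at those in `C`. The cutoff on `#S` is what the second moment bound needs;
  -- its failure is charged separately.
  set Δ : (X : Type) → Finset (Fin (ℓ * n)) → (Fin (ℓ * n) → X) → ℝ := fun X S U =>
    if #S ≤ 2 * (#C * ℓ) then ∑ H, f H * (indepEdgeMass (ℓ * n) (multipartiteProb ℓ q S U) H
          - indepEdgeMass (ℓ * n) (denseProb q S) H) else 0 with hΔ
  have hsplit : ∀ V : Fin (ℓ * n) → Fin n,
      ∑ H, f H * (indepEdgeMass (ℓ * n) (multipartiteProb ℓ q (childrenOf C V) V) H
          - indepEdgeMass (ℓ * n) (denseProb q (childrenOf C V)) H)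
      ≤ (if 2 * (#C * ℓ) < #(childrenOf C V) then 1 else 0) + Δ (Fin n) (childrenOf C V) V := fun V => by
    simp only [hΔ]
    split_ifs with h1 h2
    · omega
    · rw [add_zero]
      exact sum_mul_sub_le_one (isProbMass_multipartite hq0 hq _ _) (isProbMass_dense hq0 hq _)
        hf0 hf1
    · rw [zero_add]
    · omega
  have hΔU : ∀ S, (1 / c) * ∑ U : Fin (ℓ * n) → C, Δ C S U
      ≤ √(Real.exp (4 * q * (ℓ : ℝ) ^ 2) - 1) := fun S => by
    simp only [hΔ]
    split_ifs with h
    · refine le_trans (le_of_eq ?_) (sum_mul_multipartite_sub_dense_le (X := C) hℓ hq0 hqℓ S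
        (by rwa [Fintype.card_coe]) hf0 hf1)
      rw [sum_comm, mul_sum]
      refine sum_congr rfl fun H _ => ?_
      rw [← mul_sum, ← mul_sum, sum_sub_distrib, sum_const, card_univ, nsmul_eq_mul, ← hc]
      field_simp
    · simp
  have hres : ∑ V : Fin (ℓ * n) → Fin n, w * Δ (Fin n) (childrenOf C V) V
      ≤ √(Real.exp (4 * q * (ℓ : ℝ) ^ 2) - 1) := by
    have h := card_mul_sum_eq_sum_resample C (fun S V => w * Δ (Fin n) S V) (fun S U => w * Δ C S U)
      fun S V U hVU => by
        simp only [hΔ]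
        rw [multipartiteProb_congr (ℓ := ℓ) (q := q) (Subtype.val : C → Fin n)
          Subtype.val_injective hVU]
    rw [← hc] at h
    calc _ = (1 / c) * (c * ∑ V : Fin (ℓ * n) → Fin n, w * Δ (Fin n) (childrenOf C V) V) := by
          field_simp
      _ = ∑ V : Fin (ℓ * n) → Fin n, w * ((1 / c) * ∑ U : Fin (ℓ * n) → C,
            Δ C (childrenOf C V) U) := by
          rw [h, mul_sum]
          refine sum_congr rfl fun V _ => ?_
          rw [← mul_sum]
          ring
      _ ≤ ∑ _V : Fin (ℓ * n) → Fin n, w * √(Real.exp (4 * q * (ℓ : ℝ) ^ 2) - 1) :=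
          sum_le_sum fun V _ => mul_le_mul_of_nonneg_left (hΔU _) hw0
      _ = _ := by rw [← sum_mul, sum_uniform_fin_eq_one hn, one_mul]
  calc _ ≤ ∑ V : Fin (ℓ * n) → Fin n, w *
        ((if 2 * (#C * ℓ) < #(childrenOf C V) then 1 else 0) + Δ (Fin n) (childrenOf C V) V) :=
        sum_le_sum fun V _ => mul_le_mul_of_nonneg_left (hsplit V) hw0
    _ ≤ _ := by
        simp only [mul_add, sum_add_distrib]
        exact add_le_add (sum_uniform_card_childrenOf_gt_le hn C) hres

/-- Bernoulli's inequality gives `4 (e ^ y - 1) ≤ e ^ (4y) - 1`; the factor `4` becomes the `0.5`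
outside the root, and `4y = 16 q ℓ²` is well below the stated exponent. -/
theorem sqrt_exp_sub_one_le (hq0 : 0 < q) (ℓ : ℕ) :
    √(Real.exp (4 * q * (ℓ : ℝ) ^ 2) - 1)
      ≤ 0.5 * √(Real.exp (72 * Real.exp 1 ^ 2 * q * (ℓ : ℝ) ^ 2) - 1) := by
  set y := 4 * q * (ℓ : ℝ) ^ 2 with hy
  have hy0 : 0 ≤ y := by positivity
  have h1 : 4 * y ≤ 72 * Real.exp 1 ^ 2 * q * (ℓ : ℝ) ^ 2 := by
    have he : (1 : ℝ) ≤ Real.exp 1 ^ 2 := one_le_pow₀ (Real.one_le_exp zero_le_one)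
    have hz : 0 ≤ q * (ℓ : ℝ) ^ 2 := by positivity
    rw [hy]
    nlinarith
  have h2 : 4 * (Real.exp y - 1) ≤ Real.exp (72 * Real.exp 1 ^ 2 * q * (ℓ : ℝ) ^ 2) - 1 := by
    have h3 := one_add_mul_le_pow (a := Real.exp y - 1) (by linarith [Real.exp_pos y]) 4
    rw [add_sub_cancel, ← Real.exp_nat_mul] at h3
    push_cast at h3
    linarith [Real.exp_le_exp.2 h1]
  calc √(Real.exp y - 1) = 0.5 * √(4 * (Real.exp y - 1)) := by
        rw [Real.sqrt_mul (by norm_num), show (4 : ℝ) = 2 ^ 2 by norm_num,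
          Real.sqrt_sq (by norm_num)]
        ring
    _ ≤ _ := by gcongr

/-- The two comparisons add up; the last term of `ξ` enters only as a nonnegative surplus. -/
theorem sum_mul_reduction_sub_plantedDenseMass_le {k : ℕ} (hℓ : 1 ≤ ℓ) (hn : 1 ≤ n) (hk : 1 ≤ k)
    (hq0 : 0 < q) (hqℓ : 16 * q * (ℓ : ℝ) ^ 2 ≤ 1) (hγ0 : 0 < γ) (hγ : γ ≤ 1 / 2)
    {C : Finset (Fin n)} (hC : #C = k) (hf0 : ∀ H, 0 ≤ f H) (hf1 : ∀ H, f H ≤ 1) :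
    ∑ H, f H * (∑ V : Fin (ℓ * n) → Fin n, (1 / (n : ℝ)) ^ (ℓ * n) *
          blockMass V (plantedCountMass ℓ (2 * q) q γ C V) H)
      ≤ ∑ H, f H * plantedDenseMass (ℓ * n) (k * ℓ) (2 * q) q H + xiBound ℓ k q γ := by
  have hCne : C.Nonempty := card_pos.1 (by omega)
  have h1 := sum_uniform_blockMass_sub_multipartite_le hℓ hn hq0 hqℓ hγ0 hγ C hf0 hf1
  have h2 := sum_uniform_multipartite_sub_dense_le hℓ hn hq0 hqℓ hCne hf0 hf1
  have h3 := sqrt_exp_sub_one_le hq0 ℓ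
  have h4 : (k : ℝ) * Real.exp (-(ℓ : ℝ) / 12) ≤ 1.5 * k * Real.exp (-(ℓ : ℝ) / 18) := by
    have h5 : Real.exp (-(ℓ : ℝ) / 12) ≤ Real.exp (-(ℓ : ℝ) / 18) := by
      have : (0 : ℝ) ≤ ℓ := by positivity
      exact Real.exp_le_exp.2 (by linarith)
    have h6 : (0 : ℝ) ≤ k * Real.exp (-(ℓ : ℝ) / 18) := by positivity
    have h7 := mul_le_mul_of_nonneg_left h5 (Nat.cast_nonneg (α := ℝ) k)
    linarith
  have h8 : 0 ≤ √(0.5 * (k : ℝ)) * Real.exp (-(ℓ : ℝ) / 36) := by positivity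
  have hswap : ∀ μ : (Fin (ℓ * n) → Fin n) → SimpleGraph (Fin (ℓ * n)) → ℝ,
      ∑ H, f H * ∑ V, (1 / (n : ℝ)) ^ (ℓ * n) * μ V H
        = ∑ V, (1 / (n : ℝ)) ^ (ℓ * n) * ∑ H, f H * μ V H := fun μ => by
    simp only [mul_sum]
    rw [sum_comm]
    exact sum_congr rfl fun V _ => sum_congr rfl fun H _ => by ring
  simp only [plantedDenseMass_eq_sum hℓ hn q C hC, hswap]
  simp only [mul_sub, sum_sub_distrib] at h1 h2
  rw [hC] at h1 h2
  unfold xiBound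
  linarith

end Averaged

/-! ### The error of the reduced test -/

theorem sum_erdosRenyiMass_mul_compTest {n N : ℕ} (γ : ℝ)
    (R : SimpleGraph (Fin n) → SimpleGraph (Fin N) → ℝ) (φ : SimpleGraph (Fin N) → Bool) (b : Bool)
    (C : Finset (Fin n)) :
    ∑ G, erdosRenyiMass n γ G * compTest R φ (G ⊔ cliqueOn C) b
      = ∑ H, detTest φ H b * ∑ G, erdosRenyiMass n γ G * R (G ⊔ cliqueOn C) H := by
  simp only [compTest, mul_sum]
  rw [sum_comm]
  exact sum_congr rfl fun H _ => sum_congr rfl fun G _ => by ring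

theorem sum_plantedCliqueMass_mul {n k : ℕ} (γ : ℝ) (ψ : SimpleGraph (Fin n) → ℝ) :
    ∑ G, plantedCliqueMass n k γ G * ψ G
      = ∑ C ∈ powersetCard k (univ : Finset (Fin n)), ((n.choose k : ℝ))⁻¹ *
        ∑ G, erdosRenyiMass n γ G * ψ (G ⊔ cliqueOn C) := by
  classical
  simp only [plantedCliqueMass, sum_mul]
  rw [sum_comm]
  refine sum_congr rfl fun C _ => ?_
  simp only [mul_assoc, ← mul_sum, sum_mul]
  rw [sum_comm]
  congr 1
  refine sum_congr rfl fun G _ => ?_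
  rw [← mul_sum]
  simp

theorem cliqueOn_empty {n : ℕ} : cliqueOn (∅ : Finset (Fin n)) = ⊥ := by
  ext
  simp [cliqueOn]

/-- The null hypothesis is the planted computation with the empty clique: every block is then
binomial with parameter `q`, whatever the parents. -/
theorem sum_erdosRenyiMass_mul_reductionMass_eq {ℓ n N : ℕ} {q γ : ℝ} (hn : 1 ≤ n) (hq0 : 0 ≤ q)
    (hq1 : q ≤ 1) (hγ0 : 0 < γ) (hγ1 : γ < 1) (H : SimpleGraph (Fin N)) :
    ∑ G : SimpleGraph (Fin n), erdosRenyiMass n γ G * reductionMass ℓ (2 * q) q γ G H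
      = erdosRenyiMass N q H := by
  have h := sum_erdosRenyiMass_mul_reductionMass ℓ (2 * q) q hγ0 hγ1 (∅ : Finset (Fin n)) H
  simp only [cliqueOn_empty, sup_bot_eq] at h
  rw [h, erdosRenyiMass_eq N q hq0 hq1]
  have hV : ∀ V : Fin N → Fin n, ∏ st ∈ blockIndices n, sizeMass (blockPairs V st.1 st.2)
      (plantedCountMass ℓ (2 * q) q γ ∅ V st.1 st.2) (edgesOf H ∩ blockPairs V st.1 st.2)
      = indepEdgeMass N (fun _ => q) H := fun V => by
    rw [← blockMass_binomMass (V := V) (fun _ => q) (fun _ _ => q) (fun _ _ _ _ => rfl)]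
    have : plantedCountMass ℓ (2 * q) q γ ∅ V = fun s t => binomMass #(blockPairs V s t) q := by
      funext s t m
      simp [plantedCountMass]
    rw [this, blockMass]
  simp only [hV]
  rw [← sum_mul, sum_uniform_fin_eq_one hn, one_mul]

theorem detTest_nonneg {Ω : Type*} (φ : Ω → Bool) (ω : Ω) (b : Bool) : 0 ≤ detTest φ ω b := by
  unfold detTest; split_ifs <;> norm_num

theorem detTest_le_one {Ω : Type*} (φ : Ω → Bool) (ω : Ω) (b : Bool) : detTest φ ω b ≤ 1 := by
  unfold detTest; split_ifs <;> norm_num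

theorem pcError_reducedTest_le {ℓ n k : ℕ} {q γ : ℝ} (hℓ : 1 ≤ ℓ) (hk : 1 ≤ k) (hkn : k ≤ n)
    (hγ0 : 0 < γ) (hγ : γ ≤ 1 / 2) (hq : 0 < q) (hqℓ : 16 * q * (ℓ : ℝ) ^ 2 ≤ 1)
    (φ : SimpleGraph (Fin (ℓ * n)) → Bool) :
    pcError n k γ (reducedTest ℓ (2 * q) q γ φ)
      ≤ pdsError (ℓ * n) (k * ℓ) (2 * q) q φ + xiBound ℓ k q γ := by
  have hn : 1 ≤ n := hk.trans hkn
  have hq16 := le_one_div_sixteen hℓ hq.le hqℓ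
  unfold pcError pdsError errorSum reducedTest
  have hI : ∑ G : SimpleGraph (Fin n), erdosRenyiMass n γ G *
      compTest (reductionMass ℓ (2 * q) q γ) φ G true
      = ∑ H, erdosRenyiMass (ℓ * n) q H * detTest φ H true := by
    have h := sum_erdosRenyiMass_mul_compTest γ (reductionMass ℓ (2 * q) q γ) φ true
      (∅ : Finset (Fin n))
    simp only [cliqueOn_empty, sup_bot_eq, sum_erdosRenyiMass_mul_reductionMass_eq hn hq.le
      (by linarith : q ≤ 1) hγ0 (by linarith : γ < 1)] at h
    rw [h]
    exact sum_congr rfl fun H _ => mul_comm _ _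
  have hII : ∑ G : SimpleGraph (Fin n), plantedCliqueMass n k γ G *
      compTest (reductionMass ℓ (2 * q) q γ) φ G false
      ≤ ∑ H, plantedDenseMass (ℓ * n) (k * ℓ) (2 * q) q H * detTest φ H false
        + xiBound ℓ k q γ := by
    rw [sum_plantedCliqueMass_mul γ fun G => compTest (reductionMass ℓ (2 * q) q γ) φ G false]
    have hch : (0 : ℝ) < n.choose k := by exact_mod_cast Nat.choose_pos hkn
    -- The bound is uniform in the clique position, so averaging over `C` costs nothing.
    have hterm : ∀ C ∈ powersetCard k (univ : Finset (Fin n)), ((n.choose k : ℝ))⁻¹ *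
        ∑ G, erdosRenyiMass n γ G *
          compTest (reductionMass ℓ (2 * q) q γ) φ (G ⊔ cliqueOn C) false
        ≤ ((n.choose k : ℝ))⁻¹ *
          (∑ H, plantedDenseMass (ℓ * n) (k * ℓ) (2 * q) q H * detTest φ H false
            + xiBound ℓ k q γ) := fun C hC => by
      refine mul_le_mul_of_nonneg_left ?_ (by positivity)
      rw [sum_erdosRenyiMass_mul_compTest]
      simp only [sum_erdosRenyiMass_mul_reductionMass ℓ (2 * q) q hγ0 (by linarith : γ < 1)]
      refine (sum_mul_reduction_sub_plantedDenseMass_le hℓ hn hk hq hqℓ hγ0 hγ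
        (mem_powersetCard.1 hC).2 (detTest_nonneg φ · false) (detTest_le_one φ · false)).trans_eq ?_
      congr 1
      exact sum_congr rfl fun H _ => mul_comm _ _
    refine (sum_le_sum hterm).trans_eq ?_
    rw [sum_const, card_powersetCard, card_univ, Fintype.card_fin, nsmul_eq_mul, ← mul_assoc,
      mul_inv_cancel₀ hch.ne', one_mul]
  rw [hI]
  linarith

end

theorem proposition4 (ℓ n k : ℕ) (q γ : ℝ) (hℓ : 1 ≤ ℓ) (hk : 1 ≤ k) (hkn : k ≤ n)
    (hγ0 : 0 < γ) (hγ : γ ≤ 1 / 2) (hq : 0 < q) (hqℓ : 16 * q * (ℓ : ℝ) ^ 2 ≤ 1)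
    (hkℓ : 6 * Real.exp 1 * (ℓ : ℝ) ≤ (k : ℝ))
    (φ : SimpleGraph (Fin (ℓ * n)) → Bool) (η : ℝ)
    (hη : pdsError (ℓ * n) (k * ℓ) (2 * q) q φ = η) :
    (∀ a b : ℕ, a ≤ 2 * ℓ → b ≤ 2 * ℓ →
      IsProbMassUpTo (a * b) (pPrimeMass (2 * q) q γ (a * b)) ∧
      IsProbMassUpTo (a * b) (qPrimeMass (2 * q) q γ (a * b))) ∧
    IsGraphKernel (n := n) (N := ℓ * n) (reductionMass ℓ (2 * q) q γ) ∧
    pcError n k γ (reducedTest ℓ (2 * q) q γ φ) ≤ η + xiBound ℓ k q γ := by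
  have hq16 := le_one_div_sixteen hℓ hq.le hqℓ
  refine ⟨fun a b ha hb => ?_,
    isGraphKernel_reductionMass (hk.trans hkn) hℓ hq.le hqℓ hγ0 hγ,
    hη ▸ pcError_reducedTest_le hℓ hk hkn hγ0 hγ hq hqℓ φ⟩
  have hL := four_mul_mul_le_one hq.le hqℓ ha hb
  exact ⟨isProbMassUpTo_pPrimeMass hq.le hq16 hγ0 hγ hL,
    isProbMassUpTo_qPrimeMass hq.le hq16 hγ0 hγ hL⟩
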